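/- Let $\{\mathbf Z_i\}_{i\in\mathbb Z}$ be a stationary, centered, $\mathbb R^J$-valued Gaussian process on a probability space such that the covariance matrix of $(\mathbf Z_1,\dots,\mathbf Z_m)$ is non-singular for every $m$. For $k\ge 0$, $m\ge 1$ let $\rho_{k,m}$ be the canonical correlation between $(\mathbf Z_1,\dots,\mathbf Z_m)$ and $(\mathbf Z_{k+1},\dots,\mathbf Z_{k+m})$, i.e. the supremum of $|\mathrm{Corr}(\langle x,(\mathbf Z_1,\dots,\mathbf Z_m)\rangle,\langle y,(\mathbf Z_{k+1},\dots,\mathbf Z_{k+m})\rangle)|$ over $x,y\in\mathbb R^{Jm}$. Assume the following. (A1) $X_i=G(\mathbf Z_i,\dots,\mathbf Z_{i-l})$ for all $i\in\mathbb Z$, where $l\ge 0$ is a fixed integer and $G$ is measurable, and $X_0$ is integrable with mean $\mu=\mathbb E X_0$. Write $S_{j,k}=\sum_{i=j}^k X_i$ and $\bar X_n=S_{1,n}/n$. (A2) There are $0<H<1$, a slowly varying function $\ell$ (measurable, eventually positive, $\ell(ax)/\ell(x)\to1$ as $x\to\infty$ for every $a>0$), and a process $\{Y(t)\}_{t\ge0}$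 that is self-similar with index $H$, has stationary increments, has càdlàg paths on $[0,1]$ and is nonzero in the sense that almost surely $Y$ does not vanish identically on $[0,1]$, such that $$\Big\{\frac{S_{1,\lfloor nt\rfloor}-\lfloor nt\rfloor\mu}{n^H\ell(n)},\ 0\le t\le 1\Big\}\Rightarrow\{Y(t),\ 0\le t\le1\}$$ weakly in $D[0,1]$ endowed with Skorokhod's $M_2$ topology. (A3) The integers $b_n$ satisfy $b_n\to\infty$, $b_n=o(n)$ and $\sum_{k=0}^n\rho_{k,l+b_n}=o(n)$ as $n\to\infty$. Let $F(x)=P(T\le x)$ be the distribution function of $T=Y(1)/D$, where $D=\big[\int_0^1\{Y(s)-sY(1)\}^2ds\big]^{1/2}$, and let $$\widehat F_{n,b_n}(x)=\frac1{n-b_n+1}\sum_{i=1}^{n-b_n+1}\mathrm I(T_{i,b_n}\le x),\qquad T_{i,b_n}=\frac{S_{i,i+b_n-1}-b_n\bar X_n}{\sqrt{b_n^{-1}\sum_{k=i}^{i+b_n-1}\big(S_{i,k}-b_n^{-1}(k-i+1)S_{i,i+b_n-1}\big)^2}}.$$ Then $\widehat F_{n,b_n}(x)\to F(x)$ in probability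 as $n\to\infty$ for every continuity point $x$ of $F$. If $F$ is continuous, then moreover $\sup_{x\in\mathbb R}|\widehat F_{n,b_n}(x)-F(x)|\to0$ in probability. -/

import Mathlib

open MeasureTheory ProbabilityTheory Filter Topology Asymptotics
open scoped NNReal ENNReal

namespace BlockSampling

noncomputable section

/-! ### The space `D[0,1]` with the `M₂` topology -/

/-- Càdlàg functions on `[0,1]`: right continuous with (finite) left limits. -/
def IsCadlag (x : unitInterval → ℝ) : Prop :=
  ∀ t, ContinuousWithinAt x (Set.Ici t) t ∧ ∃ z, Tendsto x (𝓝[<] t) (𝓝 z)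

/-- The space `D[0,1]` of càdlàg functions on `[0,1]`. -/
structure SkorokhodSpace where
  /-- the underlying function -/
  toFun : unitInterval → ℝ
  /-- it is càdlàg -/
  isCadlag : IsCadlag toFun

/-- The completed graph of `x`: the graph of `x` together with the vertical segments
`[x(t-), x(t)]` at the jump times (`x(0-) = x(0)`). -/
def completedGraph (x : SkorokhodSpace) : Set (unitInterval × ℝ) :=
  {p | p.2 ∈ Set.uIcc (Function.leftLim x.toFun p.1) (x.toFun p.1)}

/-- Skorokhod's `M₂` topology is the topology of the Hausdorff distance between completed
graphs. -/
instance : PseudoEMetricSpace SkorokhodSpace where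
  edist x y := Metric.hausdorffEDist (completedGraph x) (completedGraph y)
  edist_self _ := Metric.hausdorffEDist_self
  edist_comm _ _ := Metric.hausdorffEDist_comm
  edist_triangle _ _ _ := Metric.hausdorffEDist_triangle

instance : MeasurableSpace SkorokhodSpace := borel SkorokhodSpace

instance : BorelSpace SkorokhodSpace := ⟨rfl⟩

/-! ### Stationary, self-similar and slowly varying objects -/

variable {Ω : Type*} [MeasurableSpace Ω]

/-- A (strictly) stationary process indexed by `ℤ`. -/
def IsStationary {E : Type*} [MeasurableSpace E] (Z : ℤ → Ω → E) (P : Measure Ω) : Prop :=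
  ∀ k : ℤ, IdentDistrib (fun ω (i : ℤ) => Z (i + k) ω) (fun ω (i : ℤ) => Z i ω) P P

/-- Equality of all finite-dimensional distributions of two processes indexed by `[0,∞)`. -/
def SameFDD (U V : ℝ≥0 → Ω → ℝ) (P : Measure Ω) : Prop :=
  ∀ I : Finset ℝ≥0, IdentDistrib (fun ω (t : I) => U t ω) (fun ω (t : I) => V t ω) P P

/-- `H`-sssi processes: self-similar with Hurst index `H` and with stationary increments. -/
structure IsSSSI (H : ℝ) (Y : ℝ≥0 → Ω → ℝ) (P : Measure Ω) : Prop where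
  selfSimilar : ∀ c : ℝ≥0, 0 < c →
    SameFDD (fun t => Y (c * t)) (fun t ω => (c : ℝ) ^ H * Y t ω) P
  stationaryIncrements : ∀ h : ℝ≥0,
    SameFDD (fun t ω => Y (t + h) ω - Y h ω) (fun t ω => Y t ω - Y 0 ω) P

/-- Slowly varying functions (at infinity). -/
structure IsSlowlyVarying (ℓ : ℝ → ℝ) : Prop where
  measurable : Measurable ℓ
  eventually_pos : ∀ᶠ x in atTop, 0 < ℓ x
  tendsto_div : ∀ a : ℝ, 0 < a → Tendsto (fun x => ℓ (a * x) / ℓ x) atTop (𝓝 1)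

/-! ### Covariance structure of the underlying vector process -/

/-- The block `(Z_s, …, Z_{s+m-1})` viewed as a vector of dimension `J × m`. -/
def block {J : ℕ} (Z : ℤ → Ω → Fin J → ℝ) (s : ℤ) (m : ℕ) : Fin m × Fin J → Ω → ℝ :=
  fun p ω => Z (s + ((p.1 : ℕ) : ℤ)) ω p.2

/-- The covariance matrix `Σ_m` of `(Z_1, …, Z_m)` (for a centered process). -/
def covMat {J : ℕ} (Z : ℤ → Ω → Fin J → ℝ) (P : Measure Ω) (m : ℕ) :
    Matrix (Fin m × Fin J) (Fin m × Fin J) ℝ :=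
  Matrix.of fun p q => ∫ ω, block Z 1 m p ω * block Z 1 m q ω ∂P

/-- The correlation of two real random variables (zero if one of the variances vanishes). -/
def corr (A B : Ω → ℝ) (P : Measure Ω) : ℝ :=
  cov[A, B; P] / (√(Var[A; P]) * √(Var[B; P]))

/-- The canonical correlation `ρ(U, V)` of two finite-dimensional random vectors. -/
def canonicalCorr {ι κ : Type*} [Fintype ι] [Fintype κ] (U : ι → Ω → ℝ) (V : κ → Ω → ℝ)
    (P : Measure Ω) : ℝ :=
  ⨆ p : (ι → ℝ) × (κ → ℝ), |corr (fun ω => ∑ i, p.1 i * U i ω) (fun ω => ∑ j, p.2 j * V j ω) P|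

/-- The between-block canonical correlation `ρ_{k,m}` of `(Z_1, …, Z_m)` and
`(Z_{k+1}, …, Z_{k+m})`. -/
def blockCorr {J : ℕ} (Z : ℤ → Ω → Fin J → ℝ) (P : Measure Ω) (k m : ℕ) : ℝ :=
  canonicalCorr (block Z 1 m) (block Z ((k : ℤ) + 1) m) P

/-! ### Partial sums and self-normalized block statistics -/

/-- The partial sum `S_{j,k} = X_j + ⋯ + X_k`. -/
def partialSum (X : ℤ → Ω → ℝ) (j k : ℤ) (ω : Ω) : ℝ := ∑ i ∈ Finset.Icc j k, X i ω

/-- The sample mean of `X_1, …, X_n`. -/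
def sampleMean (X : ℤ → Ω → ℝ) (n : ℕ) (ω : Ω) : ℝ := partialSum X 1 n ω / n

/-- The normalizer `D_{i,b}` of the block `X_i, …, X_{i+b-1}`. -/
def blockNormalizer (X : ℤ → Ω → ℝ) (i : ℤ) (b : ℕ) (ω : Ω) : ℝ :=
  √((b : ℝ)⁻¹ * ∑ k ∈ Finset.Icc i (i + b - 1),
    (partialSum X i k ω - (b : ℝ)⁻¹ * ((k : ℝ) - i + 1) * partialSum X i (i + b - 1) ω) ^ 2)

/-- The self-normalized statistic `T_{i,b}` of the block `X_i, …, X_{i+b-1}`, centered at the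
mean of the whole sample `X_1, …, X_n`. -/
def blockStat (X : ℤ → Ω → ℝ) (n b : ℕ) (i : ℤ) (ω : Ω) : ℝ :=
  (partialSum X i (i + b - 1) ω - b * sampleMean X n ω) / blockNormalizer X i b ω

open Classical in
/-- The empirical distribution function of `T_{1,b}, …, T_{n-b+1,b}`. -/
def empiricalCDF (X : ℤ → Ω → ℝ) (n b : ℕ) (x : ℝ) (ω : Ω) : ℝ :=
  ((n : ℝ) - b + 1)⁻¹ *
    ∑ i ∈ Finset.Icc (1 : ℤ) ((n : ℤ) - b + 1), if blockStat X n b i ω ≤ x then (1 : ℝ) else 0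

/-- A function of `⌊n t⌋` is càdlàg in `t`. -/
theorem isCadlag_comp_floor (g : ℤ → ℝ) (n : ℕ) :
    IsCadlag fun t : unitInterval => g ⌊(n : ℝ) * (t : ℝ)⌋ := by
  have hc : Continuous fun t : unitInterval => (n : ℝ) * (t : ℝ) := by fun_prop
  intro t
  rcases Nat.eq_zero_or_pos n with rfl | hn
  · simp only [Nat.cast_zero, zero_mul]
    exact ⟨continuousWithinAt_const, _, tendsto_const_nhds⟩
  have hn' : (0 : ℝ) < n := by exact_mod_cast hn
  constructor
  · have h1 : Tendsto (fun s : unitInterval => (n : ℝ) * (s : ℝ)) (𝓝[≥] t)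
        (𝓝[≥] ((n : ℝ) * (t : ℝ))) := by
      refine tendsto_nhdsWithin_iff.2 ⟨(hc.tendsto t).mono_left nhdsWithin_le_nhds, ?_⟩
      filter_upwards [self_mem_nhdsWithin] with s hs
      exact mul_le_mul_of_nonneg_left (Subtype.coe_le_coe.2 hs) hn'.le
    have h2 := (tendsto_floor_right_pure_floor ((n : ℝ) * (t : ℝ))).comp h1
    exact ((tendsto_pure_pure g _).comp h2).mono_right (pure_le_nhds _)
  · have h1 : Tendsto (fun s : unitInterval => (n : ℝ) * (s : ℝ)) (𝓝[<] t)
        (𝓝[<] ((n : ℝ) * (t : ℝ))) := by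
      refine tendsto_nhdsWithin_iff.2 ⟨(hc.tendsto t).mono_left nhdsWithin_le_nhds, ?_⟩
      filter_upwards [self_mem_nhdsWithin] with s hs
      exact mul_lt_mul_of_pos_left (Subtype.coe_lt_coe.2 hs) hn'
    have h2 := (tendsto_floor_left_pure_ceil_sub_one ((n : ℝ) * (t : ℝ))).comp h1
    exact ⟨_, ((tendsto_pure_pure g _).comp h2).mono_right (pure_le_nhds _)⟩

/-- The normalized partial sum process
`t ↦ (S_{1,⌊nt⌋} - ⌊nt⌋ μ) / (n^H ℓ(n))`, `0 ≤ t ≤ 1`, as a random element of `D[0,1]`. -/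
def partialSumPath (X : ℤ → Ω → ℝ) (mu H : ℝ) (ℓ : ℝ → ℝ) (n : ℕ) (ω : Ω) : SkorokhodSpace where
  toFun t := (partialSum X 1 ⌊(n : ℝ) * (t : ℝ)⌋ ω - (⌊(n : ℝ) * (t : ℝ)⌋ : ℝ) * mu) /
    ((n : ℝ) ^ H * ℓ n)
  isCadlag := isCadlag_comp_floor
    (fun m => (partialSum X 1 m ω - (m : ℝ) * mu) / ((n : ℝ) ^ H * ℓ n)) n

/-- The limit statistic `T = Y(1) / D`, `D = (∫₀¹ (Y(s) - s Y(1))² ds)^{1/2}`. -/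
def limitStat (Y : ℝ≥0 → Ω → ℝ) (ω : Ω) : ℝ :=
  Y 1 ω / √(∫ s : unitInterval, (Y (unitInterval.toNNReal s) ω - (s : ℝ) * Y 1 ω) ^ 2)

/-- The distribution function `F` of `T`. -/
def limitCDF (Y : ℝ≥0 → Ω → ℝ) (P : Measure Ω) (x : ℝ) : ℝ := P.real {ω | limitStat Y ω ≤ x}

end

end BlockSampling

/-! Write `a_n = n^H ℓ(n)` and call a block statistic centered if the true mean replaces the sample
mean. The frequency of a set among the centered statistics of all blocks is an average of a
stationary sequence of bounded functions of Gaussian blocks. It concentrates around its mean as soon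
as the covariances average out, and the mean is the probability that one centered statistic lies in
the set, which is controlled by the weak limit.

Concentration. For jointly Gaussian vectors, the covariance of two `[0,1]`-valued functions is at
most twice the canonical correlation (`abs_covariance_le_two_mul_canonicalCorr`). This is proved by
replication: a vector `(U_1,…,U_m,V)` with independent copies `U_i` of `U`, each paired with `V`
like `U`, exists when `m ρ² ≤ 1`, and `V` cannot be strongly correlated with many independent
variables. The assumption on the between-block correlations and Chebyshev's inequality then give a
weak law (`measureReal_block_average_le`).

Mean. The centered statistic of the first block is a functional of the partial sum path: the value
at `1` divided by the `L²` norm of the bridge. Evaluation at continuity points and integrals of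
squares are continuous for `M₂`, so the functional is almost surely continuous at `Y` once `Y` has
no jump at `1` (`IsSSSI.ae_leftLim_one`) and its bridge is nonzero (`ae_bridgeSq_limitPath_pos`).
The discrete functional varies with `n`, hence the extended continuous mapping theorem
`limsup_measure_preimage_closed_le`.

Centering. Replacing the sample mean by `μ` costs `(b/n)(a_n/a_b)` on the scale of the normalizer,
times a tight variable. A Potter bound and `H < 1` make this vanish
(`IsSlowlyVarying.tendsto_div_mul_scale_div_scale`).

These combine in `eventually_measureReal_blockFrequency_lt`, a one-sided bound for frequencies.
Applied to a half-line and to its complement it gives pointwise consistency; monotonicity gives the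
uniform statement. -/

namespace BlockSampling

/-! ### Maximal correlation of Gaussian vectors -/

section MaximalCorrelation

variable {Ω Ω' : Type*} [MeasurableSpace Ω] [MeasurableSpace Ω']

/-- Centered Gaussian vectors with the same covariances are identically distributed. -/
theorem identDistrib_of_covariance_eq {α : Type*} [Fintype α] {P : Measure Ω} {P' : Measure Ω'}
    [IsProbabilityMeasure P] [IsProbabilityMeasure P'] {X : α → Ω → ℝ} {Y : α → Ω' → ℝ}
    (hX : HasGaussianLaw (fun ω a => X a ω) P) (hY : HasGaussianLaw (fun ω a => Y a ω) P')
    (hX0 : ∀ a, ∫ ω, X a ω ∂P = 0) (hY0 : ∀ a, ∫ ω, Y a ω ∂P' = 0)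
    (hcov : ∀ a a', cov[X a, X a'; P] = cov[Y a, Y a'; P']) :
    IdentDistrib (fun ω a => X a ω) (fun ω a => Y a ω) P P' where
  aemeasurable_fst := hX.aemeasurable
  aemeasurable_snd := hY.aemeasurable
  map_eq := by
    classical
    have := hX.isGaussian_map
    have := hY.isGaussian_map
    refine Measure.ext_of_charFunDual ?_
    ext L
    have hL : ∀ v : α → ℝ, L v = ∑ a, L (Pi.single a 1) * v a := by
      intro v
      conv_lhs => rw [← Finset.univ_sum_single v, map_sum]
      refine Finset.sum_congr rfl fun a _ => ?_
      rw [← mul_comm (v a), ← smul_eq_mul, ← map_smul, ← Pi.single_smul, smul_eq_mul, mul_one]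
    rw [hX.charFunDual_map_eq_fun, hY.charFunDual_map_eq_fun]
    have hXa : ∀ a, MemLp (X a) 2 P := fun a => (hX.eval a).memLp_two
    have hYa : ∀ a, MemLp (Y a) 2 P' := fun a => (hY.eval a).memLp_two
    have hLX : (fun ω => L fun a => X a ω) = fun ω => ∑ a, L (Pi.single a 1) * X a ω :=
      funext fun ω => hL _
    have hLY : (fun ω => L fun a => Y a ω) = fun ω => ∑ a, L (Pi.single a 1) * Y a ω :=
      funext fun ω => hL _
    rw [hLX, hLY]
    rw [integral_finsetSum _ fun a _ => ((hXa a).integrable (by norm_num)).const_mul _,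
      integral_finsetSum _ fun a _ => ((hYa a).integrable (by norm_num)).const_mul _,
      variance_fun_sum fun a => (hXa a).const_mul _, variance_fun_sum fun a => (hYa a).const_mul _]
    have hE : (∑ a, ∫ ω, L (Pi.single a 1) * X a ω ∂P) =
        ∑ a, ∫ ω, L (Pi.single a 1) * Y a ω ∂P' :=
      Finset.sum_congr rfl fun a _ => by
        rw [integral_const_mul, integral_const_mul, hX0, hY0]
    have hV : (∑ a, ∑ a', cov[fun ω => L (Pi.single a 1) * X a ω,
        fun ω => L (Pi.single a' 1) * X a' ω; P]) = ∑ a, ∑ a', cov[fun ω =>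
        L (Pi.single a 1) * Y a ω, fun ω => L (Pi.single a' 1) * Y a' ω; P'] :=
      Finset.sum_congr rfl fun a _ => Finset.sum_congr rfl fun a' _ => by
        rw [covariance_const_mul_left, covariance_const_mul_left, covariance_const_mul_right,
          covariance_const_mul_right, hcov]
    rw [hE, hV]

/-- Restricting a Gaussian vector along a map of index sets. -/
theorem HasGaussianLaw.comp_index {α β : Type*} [Fintype α] [Fintype β] {P : Measure Ω}
    {X : β → Ω → ℝ} (hX : HasGaussianLaw (fun ω b => X b ω) P) (e : α → β) :
    HasGaussianLaw (fun ω a => X (e a) ω) P :=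
  hX.map_fun (ContinuousLinearMap.pi fun a => ContinuousLinearMap.proj (R := ℝ) (e a))

theorem memLp_two_of_mem_Icc {P : Measure Ω} [IsProbabilityMeasure P] {F : Ω → ℝ}
    (hF : AEMeasurable F P) (h01 : ∀ ω, F ω ∈ Set.Icc (0 : ℝ) 1) : MemLp F 2 P :=
  MemLp.of_bound hF.aestronglyMeasurable 1 (ae_of_all _ fun ω => by
    rw [Real.norm_of_nonneg (h01 ω).1]; exact (h01 ω).2)

theorem variance_le_one_of_mem_Icc {P : Measure Ω} [IsProbabilityMeasure P] {F : Ω → ℝ}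
    (hF : AEMeasurable F P) (h01 : ∀ ω, F ω ∈ Set.Icc (0 : ℝ) 1) : Var[F; P] ≤ 1 := by
  refine (variance_le_sq_of_bounded (ae_of_all _ h01) hF).trans ?_
  norm_num

theorem abs_covariance_le {P : Measure Ω} [IsProbabilityMeasure P] {A B : Ω → ℝ}
    (hA : MemLp A 2 P) (hB : MemLp B 2 P) : |cov[A, B; P]| ≤ √Var[A; P] * √Var[B; P] := by
  rw [← Real.sqrt_mul (variance_nonneg _ _)]
  refine Real.abs_le_sqrt ?_
  have h : ∀ t : ℝ, 0 ≤ Var[A; P] * (t * t) + (-2 * cov[A, B; P]) * t + Var[B; P] := by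
    intro t
    have h1 := variance_fun_sub (hA.const_mul t) hB
    rw [variance_const_mul, covariance_const_mul_left] at h1
    have h2 := variance_nonneg (fun ω => t * A ω - B ω) P
    linarith
  have := discrim_le_zero h
  rw [discrim] at this
  linarith

theorem covariance_comp_eq_of_identDistrib {γ : Type*} [MeasurableSpace γ] {P : Measure Ω}
    {P' : Measure Ω'} {U : Ω → γ} {V : Ω' → γ} (h : IdentDistrib U V P P') {f g : γ → ℝ}
    (hf : Measurable f) (hg : Measurable g) :
    cov[fun ω => f (U ω), fun ω => g (U ω); P] = cov[fun ω => f (V ω), fun ω => g (V ω); P'] := by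
  rw [← covariance_map_fun hf.aestronglyMeasurable hg.aestronglyMeasurable h.aemeasurable_fst,
    ← covariance_map_fun hf.aestronglyMeasurable hg.aestronglyMeasurable h.aemeasurable_snd,
    h.map_eq]

variable {ι κ : Type*} [Fintype ι] [Fintype κ]

/-- The covariance matrix of a vector `(U₁, …, U_m, V)` in which `U₁, …, U_m` are independent
copies of `U` and `(U_i, V)` is distributed as `(U, V)`. -/
noncomputable def replicaCov (U : ι → Ω → ℝ) (V : κ → Ω → ℝ) (P : Measure Ω) (m : ℕ) :
    Matrix ((Fin m × ι) ⊕ κ) ((Fin m × ι) ⊕ κ) ℝ :=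
  Matrix.of fun
    | .inl p, .inl q => if p.1 = q.1 then cov[U p.2, U q.2; P] else 0
    | .inl p, .inr c => cov[U p.2, V c; P]
    | .inr c, .inl p => cov[V c, U p.2; P]
    | .inr c, .inr d => cov[V c, V d; P]

/-- The quadratic form is `∑ Var A_i + 2 ∑ Cov(A_i, B) + Var B`. Completing the square, each copy
contributes at least `-ρ² Var B`, so `m` copies are absorbed by the single term `Var B` when `m ρ² ≤
1`. -/
theorem posSemidef_replicaCov {P : Measure Ω} [IsProbabilityMeasure P] {U : ι → Ω → ℝ}
    {V : κ → Ω → ℝ} (hU : ∀ a, MemLp (U a) 2 P) (hV : ∀ c, MemLp (V c) 2 P) {ρ : ℝ} {m : ℕ}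
    (hm : m * ρ ^ 2 ≤ 1)
    (hρ : ∀ (x : ι → ℝ) (y : κ → ℝ),
      |cov[fun ω => ∑ a, x a * U a ω, fun ω => ∑ c, y c * V c ω; P]| ≤
        ρ * (√Var[fun ω => ∑ a, x a * U a ω; P] * √Var[fun ω => ∑ c, y c * V c ω; P])) :
    (replicaCov U V P m).PosSemidef := by
  refine Matrix.PosSemidef.of_dotProduct_mulVec_nonneg ?_ fun x => ?_
  · ext p q
    rcases p with p | c <;> rcases q with q | d <;>
      simp [replicaCov, covariance_comm, eq_comm]
  set A : Fin m → Ω → ℝ := fun i ω => ∑ a, x (.inl (i, a)) * U a ω with hA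
  set B : Ω → ℝ := fun ω => ∑ c, x (.inr c) * V c ω with hB
  have hUx : ∀ i a, MemLp (fun ω => x (.inl (i, a)) * U a ω) 2 P := fun i a => (hU a).const_mul _
  have hVx : ∀ c, MemLp (fun ω => x (.inr c) * V c ω) 2 P := fun c => (hV c).const_mul _
  have hAA : ∀ i, Var[A i; P] =
      ∑ a, ∑ a', x (.inl (i, a)) * (x (.inl (i, a')) * cov[U a, U a'; P]) := by
    intro i
    rw [hA, variance_fun_sum (hUx i)]
    simp only [covariance_const_mul_left, covariance_const_mul_right]
    exact Finset.sum_congr rfl fun _ _ => Finset.sum_congr rfl fun _ _ => mul_left_comm ..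
  have hBB : Var[B; P] = ∑ c, ∑ d, x (.inr c) * (x (.inr d) * cov[V c, V d; P]) := by
    rw [hB, variance_fun_sum hVx]
    simp only [covariance_const_mul_left, covariance_const_mul_right]
    exact Finset.sum_congr rfl fun _ _ => Finset.sum_congr rfl fun _ _ => mul_left_comm ..
  have hAB : ∀ i, cov[A i, B; P] =
      ∑ a, ∑ c, x (.inl (i, a)) * (x (.inr c) * cov[U a, V c; P]) := by
    intro i
    rw [hA, hB, covariance_fun_sum_fun_sum (hUx i) hVx]
    simp only [covariance_const_mul_left, covariance_const_mul_right]
    exact Finset.sum_congr rfl fun _ _ => Finset.sum_congr rfl fun _ _ => mul_left_comm ..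
  have hQ : star x ⬝ᵥ (replicaCov U V P m).mulVec x =
      ∑ i, Var[A i; P] + 2 * ∑ i, cov[A i, B; P] + Var[B; P] := by
    simp only [dotProduct, Matrix.mulVec, Fintype.sum_sum_type, Fintype.sum_prod_type, hAA, hBB,
      hAB, replicaCov, Matrix.of_apply, star_trivial, mul_add, Finset.sum_add_distrib,
      Finset.mul_sum]
    have e1 : ∀ i a, (∑ j, ∑ a', x (.inl (i, a)) *
        ((if i = j then cov[U a, U a'; P] else 0) * x (.inl (j, a')))) =
        ∑ a', x (.inl (i, a)) * (x (.inl (i, a')) * cov[U a, U a'; P]) := by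
      intro i a
      rw [Finset.sum_eq_single i (fun j _ hj => by simp [hj.symm]) (by simp)]
      simp [mul_comm]
    simp only [e1]
    have e2 : (∑ c, ∑ i, ∑ a, x (.inr c) * (cov[V c, U a; P] * x (.inl (i, a)))) =
        ∑ i, ∑ a, ∑ c, x (.inl (i, a)) * (x (.inr c) * cov[U a, V c; P]) := by
      rw [Finset.sum_comm]
      refine Finset.sum_congr rfl fun i _ => ?_
      rw [Finset.sum_comm]
      refine Finset.sum_congr rfl fun a _ => Finset.sum_congr rfl fun c _ => ?_
      rw [covariance_comm]; ring
    rw [e2]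
    have e3 : ∀ i a c, x (.inl (i, a)) * (cov[U a, V c; P] * x (.inr c)) =
        x (.inl (i, a)) * (x (.inr c) * cov[U a, V c; P]) := fun i a c => by ring
    have e4 : ∀ c d, x (.inr c) * (cov[V c, V d; P] * x (.inr d)) =
        x (.inr c) * (x (.inr d) * cov[V c, V d; P]) := fun c d => by ring
    have e5 : ∀ i a c, 2 * (x (.inl (i, a)) * (x (.inr c) * cov[U a, V c; P])) =
        x (.inl (i, a)) * (x (.inr c) * cov[U a, V c; P]) +
        x (.inl (i, a)) * (x (.inr c) * cov[U a, V c; P]) := fun i a c => by ring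
    simp only [e3, e4, e5, Finset.sum_add_distrib]
    ring
  rw [hQ]
  set s : ℝ := √Var[B; P] with hs
  have hB2 : Var[B; P] = s ^ 2 := (Real.sq_sqrt (variance_nonneg _ _)).symm
  have hterm : ∀ i, -(ρ ^ 2 * s ^ 2) ≤ Var[A i; P] + 2 * cov[A i, B; P] := by
    intro i
    have h1 := (abs_le.1 (hρ (fun a => x (.inl (i, a))) (fun c => x (.inr c)))).1
    change -(ρ * (√Var[A i; P] * s)) ≤ cov[A i, B; P] at h1
    have h2 : Var[A i; P] = √Var[A i; P] ^ 2 := (Real.sq_sqrt (variance_nonneg _ _)).symm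
    nlinarith [sq_nonneg (√Var[A i; P] - ρ * s)]
  have hsum := Finset.sum_le_sum fun i (_ : i ∈ (Finset.univ : Finset (Fin m))) => hterm i
  rw [Finset.sum_add_distrib, ← Finset.mul_sum, Finset.sum_const, Finset.card_univ,
    Fintype.card_fin, nsmul_eq_mul] at hsum
  rw [hB2]
  nlinarith [sq_nonneg s]

/-- If the canonical correlation of the jointly Gaussian vectors `U` and `V` is at most `ρ`, and
`m ρ² ≤ 1`, then the covariance of `f(U)` and `g(V)` is at most `1 / √m` when `0 ≤ f, g ≤ 1`. -/
theorem natCast_mul_covariance_sq_le_one {P : Measure Ω} [IsProbabilityMeasure P]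
    {U : ι → Ω → ℝ} {V : κ → Ω → ℝ}
    (hUV : HasGaussianLaw (fun ω s => (Sum.elim U V : ι ⊕ κ → Ω → ℝ) s ω) P)
    (hU0 : ∀ a, ∫ ω, U a ω ∂P = 0) (hV0 : ∀ c, ∫ ω, V c ω ∂P = 0) {ρ : ℝ} {m : ℕ}
    (hm : m * ρ ^ 2 ≤ 1)
    (hρ : ∀ (x : ι → ℝ) (y : κ → ℝ),
      |cov[fun ω => ∑ a, x a * U a ω, fun ω => ∑ c, y c * V c ω; P]| ≤
        ρ * (√Var[fun ω => ∑ a, x a * U a ω; P] * √Var[fun ω => ∑ c, y c * V c ω; P]))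
    {f : (ι → ℝ) → ℝ} {g : (κ → ℝ) → ℝ} (hf : Measurable f) (hg : Measurable g)
    (hf01 : ∀ u, f u ∈ Set.Icc (0 : ℝ) 1) (hg01 : ∀ v, g v ∈ Set.Icc (0 : ℝ) 1) :
    m * cov[fun ω => f fun a => U a ω, fun ω => g fun c => V c ω; P] ^ 2 ≤ 1 := by
  classical
  have hU : ∀ a, MemLp (U a) 2 P := fun a => (hUV.eval (.inl a)).memLp_two
  have hV : ∀ c, MemLp (V c) 2 P := fun c => (hUV.eval (.inr c)).memLp_two
  have hS := posSemidef_replicaCov hU hV hm hρ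
  set S := replicaCov U V P m with hSdef
  -- The replicated vector is realised on a new space; only covariances of functions of one pair
  -- `(U_i, V)` or of two copies `U_i`, `U_j` are needed there.
  set μ := multivariateGaussian 0 S with hμ
  let W : (Fin m × ι) ⊕ κ → EuclideanSpace ℝ ((Fin m × ι) ⊕ κ) → ℝ := fun p x => x p
  have hW : HasGaussianLaw (fun x p => W p x) μ := by
    have h : HasGaussianLaw id μ := IsGaussian.hasGaussianLaw_id
    exact h.map_equiv_fun (PiLp.continuousLinearEquiv 2 ℝ fun _ : (Fin m × ι) ⊕ κ => ℝ)
  have hWcov : ∀ p q, cov[W p, W q; μ] = S p q := fun p q =>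
    covariance_eval_multivariateGaussian hS p q
  have hW0 : ∀ p, ∫ x, W p x ∂μ = 0 := by
    intro p
    have h := ContinuousLinearMap.integral_comp_comm
      (EuclideanSpace.proj (𝕜 := ℝ) p) (IsGaussian.integrable_id (μ := μ))
    simp only [id, hμ, integral_id_multivariateGaussian] at h
    simpa [W] using h
  set e : Fin m → ι ⊕ κ → (Fin m × ι) ⊕ κ := fun i => Sum.map (fun a => (i, a)) id with he
  have hid : ∀ i, IdentDistrib (fun ω s => (Sum.elim U V : ι ⊕ κ → Ω → ℝ) s ω)
      (fun x s => W (e i s) x) P μ := by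
    intro i
    refine identDistrib_of_covariance_eq hUV (HasGaussianLaw.comp_index hW (e i)) ?_
      (fun s => hW0 _) ?_
    · rintro (a | c)
      exacts [hU0 a, hV0 c]
    · rintro (a | c) (a' | c') <;> rw [hWcov] <;> simp [he, hSdef, replicaCov]
  set F : Fin m → EuclideanSpace ℝ ((Fin m × ι) ⊕ κ) → ℝ :=
    fun i x => f fun a => W (.inl (i, a)) x with hF
  set K : EuclideanSpace ℝ ((Fin m × ι) ⊕ κ) → ℝ := fun x => g fun c => W (.inr c) x with hK
  have hWm : ∀ p, Measurable (W p) := fun p => by fun_prop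
  have hFm : ∀ i, Measurable (F i) := fun i => hf.comp (measurable_pi_lambda _ fun a => hWm _)
  have hKm : Measurable K := hg.comp (measurable_pi_lambda _ fun a => hWm _)
  have hF2 : ∀ i, MemLp (F i) 2 μ := fun i =>
    memLp_two_of_mem_Icc (hFm i).aemeasurable fun x => hf01 _
  have hK2 : MemLp K 2 μ := memLp_two_of_mem_Icc hKm.aemeasurable fun x => hg01 _
  set t := cov[fun ω => f fun a => U a ω, fun ω => g fun c => V c ω; P] with ht
  have hFK : ∀ i, cov[F i, K; μ] = t := by
    intro i
    have hf' : Measurable fun w : ι ⊕ κ → ℝ => f fun a => w (.inl a) :=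
      hf.comp (by fun_prop)
    have hg' : Measurable fun w : ι ⊕ κ → ℝ => g fun c => w (.inr c) :=
      hg.comp (by fun_prop)
    exact (covariance_comp_eq_of_identDistrib (hid i) hf' hg').symm
  have hFF : ∀ i j, i ≠ j → cov[F i, F j; μ] = 0 := by
    intro i j hij
    refine IndepFun.covariance_eq_zero ?_ (hF2 i) (hF2 j)
    refine IndepFun.comp (φ := f) (ψ := f) (HasGaussianLaw.indepFun_of_covariance_eval
      (X := fun a => W (.inl (i, a))) (Y := fun a => W (.inl (j, a))) ?_ ?_) hf hf
    · exact hW.map_fun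
        ((ContinuousLinearMap.pi fun a : ι => ContinuousLinearMap.proj (R := ℝ)
          (φ := fun _ : (Fin m × ι) ⊕ κ => ℝ) (.inl (i, a))).prod
        (ContinuousLinearMap.pi fun a : ι => ContinuousLinearMap.proj (R := ℝ)
          (φ := fun _ : (Fin m × ι) ⊕ κ => ℝ) (.inl (j, a))))
    · intro a a'
      rw [hWcov]
      simp [hSdef, replicaCov, hij]
  have hvar : Var[fun x => ∑ i, t * F i x; μ] ≤ m * t ^ 2 := by
    rw [variance_fun_sum fun i => (hF2 i).const_mul t]
    have : ∀ i, ∑ j, cov[fun x => t * F i x, fun x => t * F j x; μ] = t ^ 2 * Var[F i; μ] := by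
      intro i
      rw [Finset.sum_eq_single i (fun j _ hj => by
        rw [covariance_const_mul_left, covariance_const_mul_right, hFF i j hj.symm]; ring)
        (by simp), covariance_self ((hFm i).const_mul t).aemeasurable, variance_const_mul]
    simp only [this]
    calc ∑ i, t ^ 2 * Var[F i; μ] ≤ ∑ _i : Fin m, t ^ 2 * 1 := by
          gcongr with i
          exact variance_le_one_of_mem_Icc (hFm i).aemeasurable fun x => hf01 _
      _ = m * t ^ 2 := by simp
  have hcov : cov[fun x => ∑ i, t * F i x, K; μ] = m * t ^ 2 := by
    rw [covariance_fun_sum_left (fun i => (hF2 i).const_mul t) hK2]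
    simp only [covariance_const_mul_left, hFK, Finset.sum_const, Finset.card_univ,
      Fintype.card_fin, nsmul_eq_mul]
    ring
  -- The variance of `t ∑ f(U_i) - g(V)` is nonnegative and at most `m t² - 2 m t² + 1`, whence `m
  -- t² ≤ 1`.
  have hsub := variance_fun_sub (memLp_finsetSum _ fun i (_ : i ∈ Finset.univ) =>
    (hF2 i).const_mul t) hK2
  rw [hcov] at hsub
  have h0 := variance_nonneg (fun x => ∑ i, t * F i x - K x) μ
  have hKv : Var[K; μ] ≤ 1 := variance_le_one_of_mem_Icc hKm.aemeasurable fun x => hg01 _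
  linarith

/-- For `ρ > 0` the largest admissible `m` is `⌊1/ρ²⌋`. If `|c| > 2ρ` then `ρ < 1/2`, so `m ρ² > 1 -
ρ² > 3/4` and `m c² > 3`. For `ρ = 0` every `m` is admissible. The factor `2` pays for the rounding
of `1/ρ²`. -/
theorem abs_le_two_mul_of_forall_natCast {c ρ : ℝ} (hc : |c| ≤ 1) (hρ : 0 ≤ ρ)
    (h : ∀ m : ℕ, m * ρ ^ 2 ≤ 1 → m * c ^ 2 ≤ 1) : |c| ≤ 2 * ρ := by
  by_contra! hlt
  have hρ2 : ρ < 1 / 2 := by linarith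
  have hcpos : 0 < |c| := by linarith
  rcases hρ.eq_or_lt with rfl | hpos
  · obtain ⟨m, hm⟩ := exists_nat_gt (1 / c ^ 2)
    have hc2 : 0 < c ^ 2 := by rw [← sq_abs]; positivity
    rw [div_lt_iff₀ hc2] at hm
    linarith [h m (by simp)]
  · have h1 : (⌊1 / ρ ^ 2⌋₊ : ℝ) ≤ 1 / ρ ^ 2 := Nat.floor_le (by positivity)
    have h2 : 1 / ρ ^ 2 < ⌊1 / ρ ^ 2⌋₊ + 1 := Nat.lt_floor_add_one _
    have h3 := h ⌊1 / ρ ^ 2⌋₊ (by rwa [le_div_iff₀ (by positivity)] at h1)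
    rw [div_lt_iff₀ (by positivity)] at h2
    have h4 : 4 * ρ ^ 2 < c ^ 2 := by rw [← sq_abs c]; nlinarith
    have hm0 : (0 : ℝ) ≤ ⌊1 / ρ ^ 2⌋₊ := by positivity
    nlinarith

/-- The maximal correlation of two jointly Gaussian vectors is controlled by their canonical
correlation. -/
theorem abs_covariance_le_two_mul_canonicalCorr {P : Measure Ω} [IsProbabilityMeasure P]
    {U : ι → Ω → ℝ} {V : κ → Ω → ℝ}
    (hUV : HasGaussianLaw (fun ω s => (Sum.elim U V : ι ⊕ κ → Ω → ℝ) s ω) P)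
    (hU0 : ∀ a, ∫ ω, U a ω ∂P = 0) (hV0 : ∀ c, ∫ ω, V c ω ∂P = 0)
    {f : (ι → ℝ) → ℝ} {g : (κ → ℝ) → ℝ} (hf : Measurable f) (hg : Measurable g)
    (hf01 : ∀ u, f u ∈ Set.Icc (0 : ℝ) 1) (hg01 : ∀ v, g v ∈ Set.Icc (0 : ℝ) 1) :
    |cov[fun ω => f fun a => U a ω, fun ω => g fun c => V c ω; P]| ≤
      2 * canonicalCorr U V P := by
  have hU : ∀ a, MemLp (U a) 2 P := fun a => (hUV.eval (.inl a)).memLp_two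
  have hV : ∀ c, MemLp (V c) 2 P := fun c => (hUV.eval (.inr c)).memLp_two
  have hA : ∀ x : ι → ℝ, MemLp (fun ω => ∑ a, x a * U a ω) 2 P := fun x =>
    memLp_finsetSum _ fun a _ => (hU a).const_mul _
  have hB : ∀ x : κ → ℝ, MemLp (fun ω => ∑ a, x a * V a ω) 2 P := fun x =>
    memLp_finsetSum _ fun a _ => (hV a).const_mul _
  have hbdd : BddAbove (Set.range fun p : (ι → ℝ) × (κ → ℝ) =>
      |corr (fun ω => ∑ i, p.1 i * U i ω) (fun ω => ∑ j, p.2 j * V j ω) P|) := by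
    refine ⟨1, ?_⟩
    rintro _ ⟨p, rfl⟩
    simp only [corr, abs_div]
    rw [abs_of_nonneg (by positivity : 0 ≤ √Var[fun ω => ∑ i, p.1 i * U i ω; P] *
      √Var[fun ω => ∑ i, p.2 i * V i ω; P])]
    refine div_le_one_of_le₀ ?_ (by positivity)
    exact abs_covariance_le (hA _) (hB _)
  have hρ0 : 0 ≤ canonicalCorr U V P := Real.iSup_nonneg fun p => abs_nonneg _
  have hρ : ∀ (x : ι → ℝ) (y : κ → ℝ),
      |cov[fun ω => ∑ a, x a * U a ω, fun ω => ∑ c, y c * V c ω; P]| ≤ canonicalCorr U V P *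
        (√Var[fun ω => ∑ a, x a * U a ω; P] * √Var[fun ω => ∑ c, y c * V c ω; P]) := by
    intro x y
    have h1 := le_ciSup hbdd (x, y)
    change |corr _ _ P| ≤ canonicalCorr U V P at h1
    simp only [corr, abs_div] at h1
    have h3 := abs_covariance_le (hA x) (hB y)
    rw [abs_of_nonneg (by positivity : 0 ≤ √Var[fun ω => ∑ i, x i * U i ω; P] *
      √Var[fun ω => ∑ i, y i * V i ω; P])] at h1
    -- If a variance vanishes, `corr` is zero by convention and carries no information; the
    -- covariance is then zero by Cauchy–Schwarz.
    rcases (by positivity : 0 ≤ √Var[fun ω => ∑ i, x i * U i ω; P] *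
      √Var[fun ω => ∑ i, y i * V i ω; P]).eq_or_lt with h2 | h2
    · rw [← h2] at h3 ⊢; simpa using h3
    · rwa [div_le_iff₀ h2] at h1
  refine abs_le_two_mul_of_forall_natCast ?_ hρ0 fun m hm =>
    natCast_mul_covariance_sq_le_one hUV hU0 hV0 hm hρ hf hg hf01 hg01
  have hUm : AEMeasurable (fun ω a => U a ω) P :=
    aemeasurable_pi_lambda _ fun a => (hU a).aemeasurable
  have hVm : AEMeasurable (fun ω a => V a ω) P :=
    aemeasurable_pi_lambda _ fun a => (hV a).aemeasurable
  have hfU := hf.comp_aemeasurable hUm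
  have hgV := hg.comp_aemeasurable hVm
  refine (abs_covariance_le (memLp_two_of_mem_Icc hfU fun ω => hf01 _)
    (memLp_two_of_mem_Icc hgV fun ω => hg01 _)).trans ?_
  have h1 := variance_le_one_of_mem_Icc hfU fun ω => hf01 _
  have h2 := variance_le_one_of_mem_Icc hgV fun ω => hg01 _
  exact mul_le_one₀ (Real.sqrt_le_one.2 h1) (Real.sqrt_nonneg _) (Real.sqrt_le_one.2 h2)

end MaximalCorrelation


/-! ### Slowly varying functions -/

namespace IsSlowlyVarying

variable {ℓ : ℝ → ℝ}

/-- Pointwise convergence on a bounded interval implies convergence in measure; this is where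
measurability of `ℓ` enters. -/
theorem tendsto_volume_ratio (hℓ : IsSlowlyVarying ℓ) {x : ℕ → ℝ} (hx : Tendsto x atTop atTop)
    {a b : ℝ} (ha : 0 < a) :
    Tendsto (fun n => volume ({ν | 1 / 2 ≤ dist (ℓ (ν * x n) / ℓ (x n)) 1} ∩ Set.Icc a b))
      atTop (𝓝 0) := by
  have h : TendstoInMeasure (volume.restrict (Set.Icc a b))
      (fun n ν => ℓ (ν * x n) / ℓ (x n)) atTop fun _ => 1 := by
    refine tendstoInMeasure_of_tendsto_ae (fun n => ?_) ?_
    · exact ((hℓ.measurable.comp (measurable_id.mul_const _)).div_const _).aestronglyMeasurable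
    · refine (ae_restrict_iff' measurableSet_Icc).2 (ae_of_all _ fun ν hν => ?_)
      exact (hℓ.tendsto_div ν (ha.trans_le hν.1)).comp hx
  have h' := tendstoInMeasure_iff_dist.1 h (1 / 2) (by norm_num)
  simpa only [Measure.restrict_apply' measurableSet_Icc] using h'

/-- Local uniformity by a measure argument: for most `ν`, `ℓ(ν r x)` is close both to `ℓ(r x)` and
to `ℓ(x)`, and one common `ν` suffices to compare the two. The constant is `3 = (3/2)/(1/2)`. -/
theorem exists_forall_le_three_mul (hℓ : IsSlowlyVarying ℓ) :
    ∃ x₀ : ℝ, ∀ x ≥ x₀, ∀ r ∈ Set.Icc (1 : ℝ) 2, ℓ (r * x) ≤ 3 * ℓ x := by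
  by_contra! hcon
  choose x hx r hr hlt using fun n : ℕ => hcon n
  have hx_top : Tendsto x atTop atTop :=
    tendsto_atTop_mono hx tendsto_natCast_atTop_atTop
  have hrx_top : Tendsto (fun n => r n * x n) atTop atTop := by
    refine tendsto_atTop_mono' _ ?_ hx_top
    filter_upwards [hx_top.eventually_ge_atTop 0] with n hn
    exact le_mul_of_one_le_left hn (hr n).1
  have hA := (tendsto_order.1 (hℓ.tendsto_volume_ratio hx_top (b := 4) one_pos)).2
    (ENNReal.ofReal (1 / 4)) (by simp)
  have hB := (tendsto_order.1 (hℓ.tendsto_volume_ratio hrx_top (b := 2) one_pos)).2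
    (ENNReal.ofReal (1 / 4)) (by simp)
  obtain ⟨n, hA, hB, hpos, hrpos⟩ := (hA.and (hB.and ((hx_top.eventually hℓ.eventually_pos).and
    (hrx_top.eventually hℓ.eventually_pos)))).exists
  set A := {ν | 1 / 2 ≤ dist (ℓ (ν * x n) / ℓ (x n)) 1}
  set B := {ν | 1 / 2 ≤ dist (ℓ (ν * (r n * x n)) / ℓ (r n * x n)) 1}
  have hr0 : 0 < r n := one_pos.trans_le (hr n).1
  -- The exceptional sets of `ν` have total length at most `1/4 + 1/4 < 1`, as pulling back along
  -- multiplication by `r ≥ 1` does not increase length. The interval `[1,4]` contains `r ν` for all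
  -- `r, ν ∈ [1,2]`.
  have hsub : ¬ Set.Icc (1 : ℝ) 2 ⊆ (B ∩ Set.Icc 1 2) ∪ (r n * ·) ⁻¹' (A ∩ Set.Icc 1 4) := by
    intro hsub
    have h1 := (measure_mono hsub).trans (measure_union_le (μ := volume) _ _)
    rw [Real.volume_Icc, Real.volume_preimage_mul_left hr0.ne', abs_of_pos (inv_pos.2 hr0)] at h1
    have h2 : ENNReal.ofReal (r n)⁻¹ * volume (A ∩ Set.Icc 1 4) ≤ 1 * ENNReal.ofReal (1 / 4) := by
      gcongr
      rw [← ENNReal.ofReal_one]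
      exact ENNReal.ofReal_le_ofReal (inv_le_one_of_one_le₀ (hr n).1)
    have h3 := h1.trans (add_le_add hB.le h2)
    rw [one_mul, ← ENNReal.ofReal_add (by norm_num) (by norm_num),
      ENNReal.ofReal_le_ofReal_iff (by norm_num)] at h3
    norm_num at h3
  obtain ⟨ν, hν, hνn⟩ := Set.not_subset.1 hsub
  simp only [Set.mem_union, Set.mem_inter_iff, Set.mem_preimage, not_or, not_and_or] at hνn
  have hνB : ν ∉ B := hνn.1.resolve_right (not_not.2 hν)
  have hνA : r n * ν ∉ A := by
    refine hνn.2.resolve_right (not_not.2 ⟨?_, ?_⟩) <;> nlinarith [hν.1, hν.2, (hr n).1, (hr n).2]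
  simp only [A, B, Set.mem_ofPred_eq, not_le, Real.dist_eq, abs_lt] at hνA hνB
  have e : ν * (r n * x n) = r n * ν * x n := by ring
  rw [e] at hνB
  have h1 : ℓ (r n * ν * x n) < 3 / 2 * ℓ (x n) := by
    rw [← div_lt_iff₀ hpos]; linarith
  have h2 : 1 / 2 * ℓ (r n * x n) < ℓ (r n * ν * x n) := by
    rw [← lt_div_iff₀ hrpos]; linarith
  linarith [hlt n]

/-- A Potter bound. -/
theorem exists_forall_le_mul_rpow (hℓ : IsSlowlyVarying ℓ) {δ : ℝ} (hδ : 0 < δ) :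
    ∃ x₀ : ℝ, 0 < x₀ ∧ ∀ x ≥ x₀, ∀ y ≥ x, 0 < ℓ x ∧ ℓ y ≤ 3 * (y / x) ^ δ * ℓ x := by
  obtain ⟨x₁, h₁⟩ := hℓ.exists_forall_le_three_mul
  have h2δ : (1 : ℝ) < 2 ^ δ := Real.one_lt_rpow (by norm_num) hδ
  obtain ⟨x₂, h₂⟩ := eventually_atTop.1 (hℓ.eventually_pos.and
    ((tendsto_order.1 (hℓ.tendsto_div 2 two_pos)).2 _ h2δ))
  refine ⟨max 1 (max x₁ x₂), by positivity, fun x hx y hy => ⟨(h₂ x (by aesop)).1, ?_⟩⟩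
  simp only [ge_iff_le, max_le_iff] at hx
  have hx0 : 0 < x := by linarith
  have hpow : ∀ k : ℕ, ℓ (2 ^ k * x) ≤ ((2 : ℝ) ^ k) ^ δ * ℓ x := by
    intro k
    induction k with
    | zero => simp
    | succ k ih =>
      have hk : x₂ ≤ 2 ^ k * x := by
        nlinarith [one_le_pow₀ (n := k) (by norm_num : (1 : ℝ) ≤ 2)]
      have h := h₂ _ hk
      have h3 := h.2
      rw [div_lt_iff₀ h.1] at h3
      calc ℓ (2 ^ (k + 1) * x) = ℓ (2 * (2 ^ k * x)) := by ring_nf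
        _ ≤ 2 ^ δ * ℓ (2 ^ k * x) := h3.le
        _ ≤ 2 ^ δ * (((2 : ℝ) ^ k) ^ δ * ℓ x) := by gcongr
        _ = ((2 : ℝ) ^ (k + 1)) ^ δ * ℓ x := by
          rw [pow_succ, Real.mul_rpow (by positivity) (by norm_num)]; ring
  -- The `k` full doublings cost `2^δ` each, and the remaining factor in `[1,2)` costs the constant
  -- `3`.
  obtain ⟨k, hk1, hk2⟩ := exists_nat_pow_near ((one_le_div hx0).2 hy) one_lt_two
  have h2k : (0 : ℝ) < 2 ^ k := by positivity
  have h3 := h₁ (2 ^ k * x) (by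
    nlinarith [one_le_pow₀ (n := k) (by norm_num : (1 : ℝ) ≤ 2)]) (y / x / 2 ^ k) ⟨by
    rwa [one_le_div h2k], by
    rw [div_le_iff₀ h2k]; rw [pow_succ] at hk2; linarith⟩
  have e : y / x / 2 ^ k * (2 ^ k * x) = y := by field_simp
  rw [e] at h3
  have hℓx := (h₂ x hx.2.2).1
  calc ℓ y ≤ 3 * ℓ (2 ^ k * x) := h3
    _ ≤ 3 * (((2 : ℝ) ^ k) ^ δ * ℓ x) := by gcongr; exact hpow k
    _ ≤ 3 * ((y / x) ^ δ * ℓ x) := by gcongr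
    _ = _ := by ring

/-- The factor by which the error of the sample mean, summed over a block, is reduced relative to
the block scale. It is of order `(b/n)^(1-H)` up to slowly varying terms; half of the exponent is
given to the Potter bound and half remains. -/
theorem tendsto_div_mul_scale_div_scale (hℓ : IsSlowlyVarying ℓ) {H : ℝ} (hH : H < 1) {b : ℕ → ℕ}
    (hb_top : Tendsto b atTop atTop)
    (hb_o : (fun n => (b n : ℝ)) =o[atTop] fun n : ℕ => (n : ℝ)) :
    Tendsto (fun n : ℕ => (b n : ℝ) / n * (((n : ℝ) ^ H * ℓ n) / ((b n : ℝ) ^ H * ℓ (b n))))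
      atTop (𝓝 0) := by
  have hδ : 0 < (1 - H) / 2 := by linarith
  obtain ⟨x₀, hx₀, hP⟩ := hℓ.exists_forall_le_mul_rpow hδ
  have hbn : Tendsto (fun n : ℕ => (b n : ℝ) / n) atTop (𝓝 0) := hb_o.tendsto_div_nhds_zero
  have hlim : Tendsto (fun n : ℕ => 3 * ((b n : ℝ) / n) ^ ((1 - H) / 2)) atTop (𝓝 0) := by
    have := (hbn.rpow_const (p := (1 - H) / 2) (Or.inr hδ.le)).const_mul 3
    rwa [Real.zero_rpow hδ.ne', mul_zero] at this
  have hbR : Tendsto (fun n => (b n : ℝ)) atTop atTop := tendsto_natCast_atTop_atTop.comp hb_top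
  have hev : ∀ᶠ n : ℕ in atTop, x₀ ≤ b n ∧ (b n : ℝ) ≤ n ∧ 0 < (n : ℝ) ∧ 0 < ℓ n := by
    filter_upwards [hbR.eventually_ge_atTop x₀, hb_o.def one_pos, eventually_gt_atTop 0,
      tendsto_natCast_atTop_atTop.eventually hℓ.eventually_pos] with n h1 h2 h3 h4
    exact ⟨h1, by simpa using h2, by exact_mod_cast h3, h4⟩
  refine squeeze_zero' ?_ ?_ hlim
  · filter_upwards [hev] with n ⟨h1, h2, h3, h4⟩
    have := (hP _ h1 _ h2).1
    positivity
  · filter_upwards [hev] with n ⟨h1, h2, h3, h4⟩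
    obtain ⟨h5, h6⟩ := hP _ h1 _ h2
    have hb0 : 0 < (b n : ℝ) := hx₀.trans_le h1
    have hq : 0 < (b n : ℝ) / n := by positivity
    have e1 : ((n : ℝ) / b n) ^ ((1 - H) / 2) = (((b n : ℝ) / n) ^ ((1 - H) / 2))⁻¹ := by
      rw [← Real.inv_rpow hq.le, inv_div]
    have e2 : (n : ℝ) ^ H / (b n : ℝ) ^ H = (((b n : ℝ) / n) ^ H)⁻¹ := by
      rw [← Real.div_rpow h3.le hb0.le, ← Real.inv_rpow hq.le, inv_div]
    have e3 : (b n : ℝ) / n = ((b n : ℝ) / n) ^ ((1 - H) / 2) * ((b n : ℝ) / n) ^ ((1 - H) / 2) *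
        ((b n : ℝ) / n) ^ H := by
      rw [← Real.rpow_add hq, ← Real.rpow_add hq]
      ring_nf
      rw [Real.rpow_one]
    have p1 : 0 < ((b n : ℝ) / n) ^ ((1 - H) / 2) := by positivity
    have p2 : 0 < ((b n : ℝ) / n) ^ H := by positivity
    calc (b n : ℝ) / n * ((n : ℝ) ^ H * ℓ n / ((b n : ℝ) ^ H * ℓ (b n)))
        = (b n : ℝ) / n * (((n : ℝ) ^ H / (b n : ℝ) ^ H) * (ℓ n / ℓ (b n))) := by
          rw [mul_div_mul_comm]
      _ ≤ (b n : ℝ) / n * (((n : ℝ) ^ H / (b n : ℝ) ^ H) *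
          (3 * ((n : ℝ) / b n) ^ ((1 - H) / 2))) := by
          gcongr
          rwa [div_le_iff₀ h5]
      _ = 3 * ((b n : ℝ) / n) ^ ((1 - H) / 2) := by
          rw [e1, e2]
          nth_rewrite 1 [e3]
          field_simp

end IsSlowlyVarying


/-! ### Càdlàg functions -/

theorem abs_sub_le_of_mem_uIcc {a b c v ε : ℝ} (hv : v ∈ Set.uIcc a b) (ha : |a - c| ≤ ε)
    (hb : |b - c| ≤ ε) : |v - c| ≤ ε := by
  rw [abs_le] at ha hb ⊢
  rcases Set.mem_uIcc.1 hv with h | h <;> constructor <;> linarith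

/-- The left limit lies in every closed ball which eventually contains the function. -/
theorem abs_leftLim_sub_le {x : unitInterval → ℝ} (hx : IsCadlag x) {s : unitInterval} {c ε : ℝ}
    (h : ∀ᶠ u in 𝓝 s, |x u - c| ≤ ε) : |Function.leftLim x s - c| ≤ ε := by
  by_cases hbot : 𝓝[<] s = ⊥
  · rw [leftLim_eq_of_eq_bot x hbot]
    exact h.self_of_nhds
  · have : (𝓝[<] s).NeBot := ⟨hbot⟩
    have ht := tendsto_leftLim_of_tendsto (hx s).2
    exact le_of_tendsto (ht.sub_const c).abs (h.filter_mono nhdsWithin_le_nhds)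

namespace IsCadlag

variable {x : unitInterval → ℝ}

theorem exists_forall_abs_le (hx : IsCadlag x) : ∃ M, ∀ t, |x t| ≤ M := by
  have h := isCompact_univ.induction_on (X := unitInterval)
    (p := fun s => ∃ M, ∀ t ∈ s, |x t| ≤ M) ⟨0, by simp⟩
    (fun s t hst ⟨M, hM⟩ => ⟨M, fun u hu => hM u (hst hu)⟩)
    (fun s t ⟨M, hM⟩ ⟨N, hN⟩ => ⟨max M N, fun u hu => hu.elim
      (fun h => (hM u h).trans (le_max_left _ _)) fun h => (hN u h).trans (le_max_right _ _)⟩) ?_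
  · simpa using h
  · intro t _
    rw [nhdsWithin_univ]
    obtain ⟨hr, z, hl⟩ := hx t
    have h1 : ∀ᶠ u in 𝓝[≥] t, |x u| < |x t| + 1 :=
      hr.abs.eventually_lt_const (by linarith)
    have h2 : ∀ᶠ u in 𝓝[<] t, |x u| < |z| + 1 :=
      hl.abs.eventually_lt_const (by linarith)
    refine ⟨{u | |x u| ≤ max (|x t| + 1) (|z| + 1)}, ?_, _, fun u hu => hu⟩
    rw [← nhdsLT_sup_nhdsGE]
    exact mem_sup.2 ⟨h2.mono fun u hu => hu.le.trans (le_max_right _ _),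
      h1.mono fun u hu => hu.le.trans (le_max_left _ _)⟩

theorem continuousAt_of_leftLim_eq (hx : IsCadlag x) {t : unitInterval}
    (ht : Function.leftLim x t = x t) : ContinuousAt x t := by
  have h := tendsto_leftLim_of_tendsto (hx t).2
  rw [ht] at h
  rw [ContinuousAt, ← nhdsLT_sup_nhdsGE]
  exact tendsto_sup.2 ⟨h, (hx t).1⟩

/-- A one-sided limit at `t` forces small oscillation on that side, hence no large jump in a
punctured neighbourhood of `t`; compactness of `[0,1]` concludes. -/
theorem finite_setOf_lt_abs_jump (hx : IsCadlag x) {ε : ℝ} (hε : 0 < ε) :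
    {t | ε < |x t - Function.leftLim x t|}.Finite := by
  set J := {t | ε < |x t - Function.leftLim x t|} with hJ
  have key : ∀ (t : unitInterval) (c : ℝ) (S : Set unitInterval), IsOpen S →
      Tendsto x (𝓝[S] t) (𝓝 c) → ∀ᶠ s in 𝓝[S] t, s ∉ J := by
    intro t c S hS hc
    have h1 : ∀ᶠ u in 𝓝[S] t, |x u - c| ≤ ε / 2 := by
      have h2 := (hc.sub_const c).abs
      rw [sub_self, abs_zero] at h2
      exact (h2.eventually_lt_const (half_pos hε)).mono fun u hu => hu.le
    filter_upwards [eventually_eventually_nhdsWithin.2 h1, self_mem_nhdsWithin] with s hs hsS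
    rw [hS.nhdsWithin_eq hsS] at hs
    have h3 := abs_leftLim_sub_le hx hs
    have h4 := hs.self_of_nhds
    simp only [hJ, Set.mem_ofPred_eq, not_lt]
    calc |x s - Function.leftLim x s| = |(x s - c) - (Function.leftLim x s - c)| := by ring_nf
      _ ≤ |x s - c| + |Function.leftLim x s - c| := abs_sub _ _
      _ ≤ ε := by linarith
  have h := isCompact_univ.induction_on (X := unitInterval)
    (p := fun s => (s ∩ J).Finite) (by simp)
    (fun s t hst h => h.subset (Set.inter_subset_inter_left _ hst))
    (fun s t hs ht => by rw [Set.union_inter_distrib_right]; exact hs.union ht) ?_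
  · simpa using h
  · intro t _
    rw [nhdsWithin_univ]
    obtain ⟨hr, z, hl⟩ := hx t
    have h1 := key t z (Set.Iio t) isOpen_Iio hl
    have h2 := key t (x t) (Set.Ioi t) isOpen_Ioi
      (hr.mono_left (nhdsWithin_mono _ Set.Ioi_subset_Ici_self))
    have h3 : ∀ᶠ s in 𝓝[≠] t, s ∉ J := by
      rw [← nhdsLT_sup_nhdsGT]
      exact mem_sup.2 ⟨h1, h2⟩
    rw [eventually_nhdsWithin_iff] at h3
    refine ⟨_, h3, (Set.finite_singleton t).subset ?_⟩
    rintro s ⟨hs, hsJ⟩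
    by_contra hst
    exact hs hst hsJ

theorem countable_setOf_not_continuousAt (hx : IsCadlag x) :
    {t | ¬ ContinuousAt x t}.Countable := by
  refine (Set.countable_iUnion fun n : ℕ =>
    (hx.finite_setOf_lt_abs_jump (ε := 1 / ((n : ℝ) + 1)) (by positivity)).countable).mono ?_
  intro t ht
  have h : x t - Function.leftLim x t ≠ 0 := fun h =>
    ht (hx.continuousAt_of_leftLim_eq (sub_eq_zero.1 h).symm)
  exact Set.mem_iUnion.2 (exists_nat_one_div_lt (abs_pos.2 h))

theorem ae_continuousAt (hx : IsCadlag x) : ∀ᵐ t, ContinuousAt x t :=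
  hx.countable_setOf_not_continuousAt.measure_zero _

theorem aestronglyMeasurable (hx : IsCadlag x) : AEStronglyMeasurable x volume := by
  have hc := hx.countable_setOf_not_continuousAt
  have h : ContinuousOn x {t | ¬ ContinuousAt x t}ᶜ := fun t ht =>
    (not_not.1 ht).continuousWithinAt
  have h2 := h.aestronglyMeasurable hc.measurableSet.compl (μ := volume)
  rwa [Measure.restrict_eq_self_of_ae_mem] at h2
  exact hx.ae_continuousAt.mono fun t ht => not_not.2 ht

end IsCadlag

/-! ### Continuity of functionals in the `M₂` topology -/

namespace SkorokhodSpace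

/-- Only one half of the Hausdorff distance is used: the graph of `y` is close to the completed
graph of `x`. All continuity statements below rest on this. -/
theorem exists_completedGraph_near {x y : SkorokhodSpace} {δ : ℝ}
    (h : edist y x < ENNReal.ofReal δ) (t : unitInterval) :
    ∃ s v, dist t s < δ ∧ |y.toFun t - v| < δ ∧
      v ∈ Set.uIcc (Function.leftLim x.toFun s) (x.toFun s) := by
  have hmem : (t, y.toFun t) ∈ completedGraph y := Set.right_mem_uIcc
  obtain ⟨⟨s, v⟩, hsv, hd⟩ := Metric.exists_edist_lt_of_hausdorffEDist_lt hmem h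
  have hd' := edist_lt_ofReal.1 hd
  rw [Prod.dist_eq, max_lt_iff] at hd'
  exact ⟨s, v, hd'.1, hd'.2, hsv⟩

theorem eventually_edist_lt (x : SkorokhodSpace) {δ : ℝ} (hδ : 0 < δ) :
    ∀ᶠ y in 𝓝 x, edist y x < ENNReal.ofReal δ :=
  Metric.eball_mem_nhds x (ENNReal.ofReal_pos.2 hδ)

/-- Near a continuity point `t`, the completed graph of `x`, vertical segments included, stays in a
thin horizontal strip around `x(t)`, so every nearby graph does so over `t`. -/
theorem tendsto_eval {x : SkorokhodSpace} {t : unitInterval} (ht : ContinuousAt x.toFun t) :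
    Tendsto (fun y : SkorokhodSpace => y.toFun t) (𝓝 x) (𝓝 (x.toFun t)) := by
  rw [Metric.tendsto_nhds]
  intro ε hε
  obtain ⟨δ, hδ, hball⟩ := Metric.eventually_nhds_iff.1
    (Metric.tendsto_nhds.1 ht (ε / 2) (half_pos hε))
  filter_upwards [x.eventually_edist_lt (lt_min hδ (half_pos hε))] with y hy
  obtain ⟨s, v, hs, hv, hvx⟩ := exists_completedGraph_near hy t
  have hs' : dist s t < δ := by rw [dist_comm]; exact hs.trans_le (min_le_left _ _)
  have h1 : |Function.leftLim x.toFun s - x.toFun t| ≤ ε / 2 := by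
    refine abs_leftLim_sub_le x.isCadlag ?_
    filter_upwards [Metric.isOpen_ball.mem_nhds (Metric.mem_ball.2 hs')] with u hu
    exact (hball hu).le
  have h2 : |x.toFun s - x.toFun t| ≤ ε / 2 := (hball hs').le
  have h3 : |v - x.toFun t| ≤ ε / 2 := abs_sub_le_of_mem_uIcc hvx h1 h2
  calc dist (y.toFun t) (x.toFun t) = |(y.toFun t - v) + (v - x.toFun t)| := by
        rw [Real.dist_eq]; ring_nf
    _ ≤ |y.toFun t - v| + |v - x.toFun t| := abs_add_le _ _
    _ < ε := by linarith [hv.trans_le (min_le_right δ (ε / 2))]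

theorem eventually_forall_abs_le (x : SkorokhodSpace) :
    ∃ M, 0 ≤ M ∧ (∀ t, |x.toFun t| ≤ M) ∧
      ∀ᶠ y : SkorokhodSpace in 𝓝 x, ∀ t, |y.toFun t| ≤ M := by
  obtain ⟨M, hM⟩ := x.isCadlag.exists_forall_abs_le
  have hM0 : 0 ≤ M := (abs_nonneg _).trans (hM 0)
  refine ⟨M + 1, by linarith, fun t => (hM t).trans (by linarith), ?_⟩
  filter_upwards [x.eventually_edist_lt one_pos] with y hy t
  obtain ⟨s, v, -, hv, hvx⟩ := exists_completedGraph_near hy t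
  have h1 : |Function.leftLim x.toFun s - 0| ≤ M :=
    abs_leftLim_sub_le x.isCadlag (Eventually.of_forall fun u => by simpa using hM u)
  have h3 := abs_sub_le_of_mem_uIcc hvx h1 (by simpa using hM s)
  rw [sub_zero] at h3
  calc |y.toFun t| = |(y.toFun t - v) + v| := by ring_nf
    _ ≤ |y.toFun t - v| + |v| := abs_add_le _ _
    _ ≤ M + 1 := by linarith

/-- The squared norm of the bridge of `y`, with `s` replaced by its approximation `r s`. -/
noncomputable def bridgeSq (r : unitInterval → ℝ) (y : SkorokhodSpace) : ℝ :=
  ∫ s : unitInterval, (y.toFun s - r s * y.toFun 1) ^ 2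

/-- A path has at most countably many discontinuities, so the integrand converges almost everywhere,
and it is bounded locally uniformly for `M₂`. The variable `r n` accommodates the grid approximation
`⌊ns⌋/n` of `s`. -/
theorem tendsto_bridgeSq {x : SkorokhodSpace} (hx : ContinuousAt x.toFun 1)
    {r : ℕ → unitInterval → ℝ} (hr : ∀ n, Measurable (r n)) (hr1 : ∀ n s, |r n s| ≤ 1)
    (hrt : ∀ s : unitInterval, Tendsto (fun n => r n s) atTop (𝓝 (s : ℝ))) :
    Tendsto (fun p : ℕ × SkorokhodSpace => bridgeSq (r p.1) p.2) (atTop ×ˢ 𝓝 x)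
      (𝓝 (bridgeSq (fun s => s) x)) := by
  obtain ⟨M, hM0, hMx, hM⟩ := x.eventually_forall_abs_le
  refine tendsto_integral_filter_of_dominated_convergence (fun _ => (2 * M) ^ 2) ?_ ?_
    (integrable_const _) ?_
  · refine Eventually.of_forall fun p => ?_
    exact (p.2.isCadlag.aestronglyMeasurable.sub
      ((hr p.1).aestronglyMeasurable.mul_const _)).pow 2
  · filter_upwards [tendsto_snd.eventually hM] with p hp
    refine ae_of_all _ fun s => ?_
    rw [norm_pow, Real.norm_eq_abs]
    refine pow_le_pow_left₀ (abs_nonneg _) ?_ 2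
    have h1 : |r p.1 s * p.2.toFun 1| ≤ 1 * M := by
      rw [abs_mul]; exact mul_le_mul (hr1 _ _) (hp 1) (abs_nonneg _) zero_le_one
    linarith [abs_sub (p.2.toFun s) (r p.1 s * p.2.toFun 1), hp s]
  · filter_upwards [x.isCadlag.ae_continuousAt] with s hs
    exact (((tendsto_eval hs).comp tendsto_snd).sub
      (((hrt s).comp tendsto_fst).mul ((tendsto_eval hx).comp tendsto_snd))).pow 2

end SkorokhodSpace

/-! ### Integrals of step functions -/

theorem integral_comp_floor (g : ℤ → ℝ) {n : ℕ} (hn : 0 < n) :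
    ∫ s : unitInterval, g ⌊(n : ℝ) * (s : ℝ)⌋ = (n : ℝ)⁻¹ * ∑ k ∈ Finset.range n, g k := by
  have hfloor : ∀ (k : ℕ), ∀ u ∈ Set.Ico (k : ℝ) ((k + 1 : ℕ) : ℝ), g ⌊u⌋ = g k := by
    intro k u hu
    rw [Int.floor_eq_iff.2 ⟨by exact_mod_cast hu.1, by simpa using hu.2⟩]
  have hle : ∀ k : ℕ, (k : ℝ) ≤ ((k + 1 : ℕ) : ℝ) := fun k => by push_cast; linarith
  have hint : ∀ k < n, IntervalIntegrable (fun u => g ⌊u⌋) volume (k : ℝ) ((k + 1 : ℕ) : ℝ) := by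
    intro k _
    rw [intervalIntegrable_iff_integrableOn_Ico_of_le (hle k),
      integrableOn_congr_fun (hfloor k) measurableSet_Ico]
    exact integrableOn_const (by simp)
  have hsum := intervalIntegral.sum_integral_adjacent_intervals (a := fun k : ℕ => (k : ℝ)) hint
  have hpiece : ∀ k : ℕ, ∫ u in (k : ℝ)..((k + 1 : ℕ) : ℝ), g ⌊u⌋ = g k := by
    intro k
    rw [intervalIntegral.integral_congr_Ioo_of_le (hle k)
      fun u hu => hfloor k u (Set.Ioo_subset_Ico_self hu)]
    simp
  simp only [hpiece] at hsum
  rw [unitInterval.measurePreserving_coe.integral_comp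
    (MeasurableEmbedding.subtype_coe measurableSet_Icc) (fun s : ℝ => g ⌊(n : ℝ) * s⌋), hsum]
  have h1 : ∫ s in unitInterval, g ⌊(n : ℝ) * s⌋ = ∫ s in (0 : ℝ)..1, g ⌊(n : ℝ) * s⌋ := by
    rw [intervalIntegral.integral_of_le zero_le_one, integral_Icc_eq_integral_Ioc]
  rw [h1, intervalIntegral.integral_comp_mul_left (fun u => g ⌊u⌋) (by positivity)]
  simp

theorem tendsto_floor_div (s : ℝ) :
    Tendsto (fun n : ℕ => (⌊(n : ℝ) * s⌋ : ℝ) / n) atTop (𝓝 s) := by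
  have h := (tendsto_const_nhds (x := s)).sub tendsto_one_div_atTop_nhds_zero_nat
  rw [sub_zero] at h
  refine tendsto_of_tendsto_of_tendsto_of_le_of_le' h tendsto_const_nhds ?_ ?_ <;>
    filter_upwards [eventually_gt_atTop 0] with n hn
  · have hn' : (0 : ℝ) < n := by exact_mod_cast hn
    rw [le_div_iff₀ hn']
    have := Int.lt_floor_add_one ((n : ℝ) * s)
    rw [sub_mul, one_div_mul_cancel hn'.ne']
    linarith
  · have hn' : (0 : ℝ) < n := by exact_mod_cast hn
    rw [div_le_iff₀ hn']
    linarith [Int.floor_le ((n : ℝ) * s)]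

theorem abs_floor_div_le_one (n : ℕ) (s : unitInterval) :
    |(⌊(n : ℝ) * (s : ℝ)⌋ : ℝ) / n| ≤ 1 := by
  have h0 : (0 : ℝ) ≤ ⌊(n : ℝ) * (s : ℝ)⌋ := by
    exact_mod_cast Int.floor_nonneg.2 (mul_nonneg n.cast_nonneg s.2.1)
  rw [abs_of_nonneg (by positivity)]
  refine div_le_one_of_le₀ ((Int.floor_le _).trans ?_) n.cast_nonneg
  exact mul_le_of_le_one_right n.cast_nonneg s.2.2

theorem measurable_floor_div (n : ℕ) :
    Measurable fun s : unitInterval => (⌊(n : ℝ) * (s : ℝ)⌋ : ℝ) / n := by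
  fun_prop


/-! ### An extended continuous mapping theorem -/

/-- The portmanteau bound is applied to the closures of the sets of `x` with `h n x ∈ C` for some `n
≥ N`. A point in all these closures is a limit along which `h n` meets `C`, so joint convergence
puts the limiting value in the closed set `C`. No measurability of `h n` is needed. -/
theorem limsup_measure_preimage_closed_le {Ω Ω' S E : Type*} [MeasurableSpace Ω]
    [MeasurableSpace Ω'] {P : Measure Ω} [IsProbabilityMeasure P] {P' : Measure Ω'}
    [IsProbabilityMeasure P'] [PseudoEMetricSpace S] [MeasurableSpace S] [BorelSpace S]
    [TopologicalSpace E] {X : ℕ → Ω → S} {Z : Ω' → S}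
    (hX : TendstoInDistribution X atTop Z (fun _ => P) P') {h : ℕ → S → E} {h' : S → E}
    (hh : ∀ᵐ ω ∂P', Tendsto (fun p : ℕ × S => h p.1 p.2) (atTop ×ˢ 𝓝 (Z ω)) (𝓝 (h' (Z ω))))
    {C : Set E} (hC : IsClosed C) :
    limsup (fun n => P {ω | h n (X n ω) ∈ C}) atTop ≤ P' {ω | h' (Z ω) ∈ C} := by
  set A : ℕ → Set S := fun N => ⋃ n ≥ N, {x | h n x ∈ C} with hA
  have hAanti : Antitone A := fun M N hMN =>
    Set.iUnion₂_mono' fun n hn => ⟨n, hMN.trans hn, subset_rfl⟩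
  have h1 : ∀ N, limsup (fun n => P {ω | h n (X n ω) ∈ C}) atTop ≤
      (P'.map Z) (closure (A N)) := by
    intro N
    refine le_trans (limsup_le_limsup ?_)
      (ProbabilityMeasure.limsup_measure_closed_le_of_tendsto hX.tendsto
        (isClosed_closure (s := A N)))
    filter_upwards [eventually_ge_atTop N] with n hn
    change _ ≤ (P.map (X n)) (closure (A N))
    rw [Measure.map_apply_of_aemeasurable (hX.forall_aemeasurable n)
      isClosed_closure.measurableSet]
    refine measure_mono fun ω hω => subset_closure ?_
    exact Set.mem_iUnion₂.2 ⟨n, hn, hω⟩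
  have h2 := tendsto_measure_iInter_atTop (μ := P'.map Z)
    (fun N => (isClosed_closure (s := A N)).measurableSet.nullMeasurableSet)
    (fun M N hMN => closure_mono (hAanti hMN)) ⟨0, measure_ne_top _ _⟩
  have h3 := ge_of_tendsto' h2 h1
  refine h3.trans ?_
  rw [Measure.map_apply_of_aemeasurable hX.aemeasurable_limit
    (MeasurableSet.iInter fun N => isClosed_closure.measurableSet)]
  refine measure_mono_ae ?_
  filter_upwards [hh] with ω hω hmem
  by_contra hnot
  have hev := hω.eventually (hC.isOpen_compl.mem_nhds hnot)
  rw [eventually_prod_iff] at hev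
  obtain ⟨p, hp, q, hq, hpq⟩ := hev
  obtain ⟨N, hN⟩ := eventually_atTop.1 hp
  obtain ⟨y, hqy, hy⟩ := mem_closure_iff_nhds.1 (Set.mem_iInter.1 hmem N) _ hq
  obtain ⟨n, hn, hyn⟩ := Set.mem_iUnion₂.1 hy
  exact hpq (hN n hn) hqy hyn

theorem eventually_measureReal_preimage_closed_lt {Ω Ω' S E : Type*} [MeasurableSpace Ω]
    [MeasurableSpace Ω'] {P : Measure Ω} [IsProbabilityMeasure P] {P' : Measure Ω'}
    [IsProbabilityMeasure P'] [PseudoEMetricSpace S] [MeasurableSpace S] [BorelSpace S]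
    [TopologicalSpace E] {X : ℕ → Ω → S} {Z : Ω' → S}
    (hX : TendstoInDistribution X atTop Z (fun _ => P) P') {h : ℕ → S → E} {h' : S → E}
    (hh : ∀ᵐ ω ∂P', Tendsto (fun p : ℕ × S => h p.1 p.2) (atTop ×ˢ 𝓝 (Z ω)) (𝓝 (h' (Z ω))))
    {C : Set E} (hC : IsClosed C) {c : ℝ} (hc : P'.real {ω | h' (Z ω) ∈ C} < c) :
    ∀ᶠ n in atTop, P.real {ω | h n (X n ω) ∈ C} < c := by
  have h1 := limsup_measure_preimage_closed_le hX hh hC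
  have h2 : P' {ω | h' (Z ω) ∈ C} < ENNReal.ofReal c :=
    (ENNReal.lt_ofReal_iff_toReal_lt (measure_ne_top _ _)).2 hc
  filter_upwards [eventually_lt_of_limsup_lt (h1.trans_lt h2)] with n hn
  exact (ENNReal.lt_ofReal_iff_toReal_lt (measure_ne_top _ _)).1 hn

/-! ### Path properties of self-similar processes with stationary increments -/

section LimitProcess

variable {Ω : Type*} [MeasurableSpace Ω] {P : Measure Ω} {H : ℝ}
  {Y : ℝ≥0 → Ω → ℝ}

namespace IsSSSI

theorem aemeasurable (hY : IsSSSI H Y P) (t : ℝ≥0) : AEMeasurable (Y t) P := by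
  have h := (hY.selfSimilar 1 one_pos {t}).aemeasurable_fst
  simpa [Function.comp_def] using
    (measurable_pi_apply (⟨t, by simp⟩ : ({t} : Finset ℝ≥0))).comp_aemeasurable h

theorem identDistrib_mul (hY : IsSSSI H Y P) {c : ℝ≥0} (hc : 0 < c) :
    IdentDistrib (Y c) (fun ω => (c : ℝ) ^ H * Y 1 ω) P P := by
  have h := (hY.selfSimilar c hc {1}).comp
    (measurable_pi_apply (⟨1, by simp⟩ : ({1} : Finset ℝ≥0)))
  simpa [Function.comp_def] using h

theorem identDistrib_increment (hY : IsSSSI H Y P) (t h : ℝ≥0) :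
    IdentDistrib (fun ω => Y (t + h) ω - Y h ω) (fun ω => Y t ω - Y 0 ω) P P := by
  have h := (hY.stationaryIncrements h {t}).comp
    (measurable_pi_apply (⟨t, by simp⟩ : ({t} : Finset ℝ≥0)))
  simpa [Function.comp_def] using h

/-- A process with stationary increments and càdlàg paths has no fixed jump at time `1`. -/
theorem ae_leftLim_one [IsProbabilityMeasure P] (hY : IsSSSI H Y P)
    (hpath : ∀ ω, IsCadlag fun t => Y (unitInterval.toNNReal t) ω) :
    ∀ᵐ ω ∂P, Function.leftLim (fun t => Y (unitInterval.toNNReal t) ω) 1 = Y 1 ω := by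
  let q : ℕ → unitInterval := fun n => ⟨1 / ((n : ℝ) + 1), by positivity, by
    rw [div_le_one (by positivity)]; linarith [n.cast_nonneg (α := ℝ)]⟩
  have hq0 : Tendsto q atTop (𝓝 0) :=
    tendsto_subtype_rng.2 tendsto_one_div_add_atTop_nhds_zero_nat
  have hqpos : ∀ n, 0 < q n := fun n => by
    rw [← Subtype.coe_lt_coe]
    change (0 : ℝ) < 1 / ((n : ℝ) + 1)
    positivity
  have hsymm : Tendsto (fun n => unitInterval.symm (q n)) atTop (𝓝[<] 1) := by
    refine tendsto_nhdsWithin_iff.2 ⟨?_, Eventually.of_forall fun n => ?_⟩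
    · have := (unitInterval.continuous_symm.tendsto 0).comp hq0
      rwa [unitInterval.symm_zero] at this
    · rw [Set.mem_Iio, ← Subtype.coe_lt_coe]
      have := Subtype.coe_lt_coe.2 (hqpos n)
      simp only [unitInterval.coe_symm_eq, Set.Icc.coe_one, Set.Icc.coe_zero] at this ⊢
      linarith
  set D : ℕ → Ω → ℝ := fun n ω => Y 1 ω - Y (unitInterval.toNNReal (unitInterval.symm (q n))) ω
  set D' : ℕ → Ω → ℝ := fun n ω => Y (unitInterval.toNNReal (q n)) ω - Y 0 ω
  -- Stationarity moves the increment before time `1` to time `0`, where right continuity makes it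
  -- vanish; before time `1` it tends to the jump. The two limits in measure must agree.
  have hid : ∀ n, IdentDistrib (D n) (D' n) P P := by
    intro n
    have h := hY.identDistrib_increment (unitInterval.toNNReal (q n))
      (unitInterval.toNNReal (unitInterval.symm (q n)))
    rwa [unitInterval.toNNReal_add_toNNReal_symm] at h
  have hD' : TendstoInMeasure P D' atTop fun _ => 0 := by
    refine tendstoInMeasure_of_tendsto_ae
      (fun n => ((hid n).aemeasurable_snd).aestronglyMeasurable) (ae_of_all _ fun ω => ?_)
    have h1 := (hpath ω 0).1.tendsto.comp (tendsto_nhdsWithin_iff.2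
      ⟨hq0, Eventually.of_forall fun n => (hqpos n).le⟩)
    have h2 := h1.sub_const (Y 0 ω)
    simpa using h2
  have hD0 : TendstoInMeasure P D atTop fun _ => 0 := by
    rw [tendstoInMeasure_iff_norm] at hD' ⊢
    intro ε hε
    refine (hD' ε hε).congr fun n => ?_
    have hs : MeasurableSet {y : ℝ | ε ≤ ‖y - 0‖} := by measurability
    exact ((hid n).measure_mem_eq hs).symm
  have hD : TendstoInMeasure P D atTop fun ω => Y 1 ω -
      Function.leftLim (fun t => Y (unitInterval.toNNReal t) ω) 1 := by
    refine tendstoInMeasure_of_tendsto_ae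
      (fun n => ((hid n).aemeasurable_fst).aestronglyMeasurable) (ae_of_all _ fun ω => ?_)
    exact ((tendsto_leftLim_of_tendsto (hpath ω 1).2).comp hsymm).const_sub _
  filter_upwards [tendstoInMeasure_ae_unique hD hD0] with ω hω
  linarith

/-- An `H`-self-similar process with `H < 1` is not linear along the powers of `1/2`. -/
theorem measure_linear_eq_zero [IsProbabilityMeasure P] (hY : IsSSSI H Y P) (hH : H < 1) :
    P {ω | Y 1 ω ≠ 0 ∧ ∀ n : ℕ, Y ((1 / 2) ^ n) ω = (1 / 2) ^ n * Y 1 ω} = 0 := by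
  set E := {ω | Y 1 ω ≠ 0 ∧ ∀ n : ℕ, Y ((1 / 2) ^ n) ω = (1 / 2) ^ n * Y 1 ω} with hE
  have hsub : E ⊆ ⋃ K : ℕ, {ω ∈ E | |Y 1 ω| ≤ K} := fun ω hω =>
    Set.mem_iUnion.2 ⟨⌈|Y 1 ω|⌉₊, hω, Nat.le_ceil _⟩
  refine measure_mono_null hsub (measure_iUnion_null fun K => ?_)
  -- On this event `0 < |Y(2^{-n})| ≤ 2^{-n} K`. By self-similarity this has the probability of `0 <
  -- |Y(1)| ≤ r^n K`, which tends to zero because `r < 1`.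
  set r : ℝ := (1 / 2) ^ (1 - H) with hr
  have hr0 : 0 < r := by positivity
  have hr1 : r < 1 := Real.rpow_lt_one (by norm_num) (by norm_num) (by linarith)
  set S : ℕ → Set Ω := fun n => {ω | Y 1 ω ≠ 0 ∧ |Y 1 ω| ≤ r ^ n * K} with hS
  have hSm : ∀ n, NullMeasurableSet (S n) P := fun n =>
    (hY.aemeasurable 1).nullMeasurable
      (s := {y : ℝ | y ≠ 0 ∧ |y| ≤ r ^ n * K}) (by measurability)
  have hSanti : Antitone S := fun m n hmn ω hω => ⟨hω.1, hω.2.trans <| by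
    have := pow_le_pow_of_le_one hr0.le hr1.le hmn
    gcongr⟩
  have hSlim := tendsto_measure_iInter_atTop hSm hSanti ⟨0, measure_ne_top _ _⟩
  have hSinter : (⋂ n, S n) = ∅ := by
    refine Set.eq_empty_of_forall_notMem fun ω hω => ?_
    have hω := Set.mem_iInter.1 hω
    have h1 := ((tendsto_pow_atTop_nhds_zero_of_lt_one hr0.le hr1).mul_const (K : ℝ))
    rw [zero_mul] at h1
    exact (hω 0).1 (abs_nonpos_iff.1 (ge_of_tendsto' h1 fun n => (hω n).2))
  rw [hSinter, measure_empty] at hSlim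
  refine le_antisymm (ge_of_tendsto' hSlim fun n => ?_) bot_le
  have hid := hY.identDistrib_mul (c := (1 / 2) ^ n) (by positivity)
  have hmeas : MeasurableSet {y : ℝ | y ≠ 0 ∧ |y| ≤ (1 / 2) ^ n * K} := by measurability
  have heq := hid.measure_mem_eq hmeas
  have hc : (((1 / 2 : ℝ≥0) ^ n : ℝ≥0) : ℝ) ^ H * r ^ n = (1 / 2) ^ n := by
    rw [hr, ← Real.rpow_natCast _ n, ← Real.rpow_mul (by norm_num)]
    push_cast
    rw [← Real.rpow_natCast _ n, ← Real.rpow_mul (by norm_num), ← Real.rpow_add (by norm_num)]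
    ring_nf
  calc P {ω ∈ E | |Y 1 ω| ≤ K}
      ≤ P (Y ((1 / 2) ^ n) ⁻¹' {y : ℝ | y ≠ 0 ∧ |y| ≤ (1 / 2) ^ n * K}) := by
        refine measure_mono fun ω hω => ?_
        have h1 := hω.1.2 n
        refine ⟨?_, ?_⟩
        · rw [h1]; exact mul_ne_zero (by positivity) hω.1.1
        · rw [h1, abs_mul, abs_of_pos (by positivity : (0 : ℝ) < (1 / 2) ^ n)]
          gcongr
          exact hω.2
    _ = P ((fun ω => (((1 / 2 : ℝ≥0) ^ n : ℝ≥0) : ℝ) ^ H * Y 1 ω) ⁻¹'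
          {y : ℝ | y ≠ 0 ∧ |y| ≤ (1 / 2) ^ n * K}) := heq
    _ ≤ P (S n) := by
        refine measure_mono fun ω hω => ?_
        obtain ⟨h1, h2⟩ := hω
        have hpos : 0 < (((1 / 2 : ℝ≥0) ^ n : ℝ≥0) : ℝ) ^ H := by
          have : (0 : ℝ) < (((1 / 2 : ℝ≥0) ^ n : ℝ≥0) : ℝ) := by positivity
          positivity
        refine ⟨right_ne_zero_of_mul h1, ?_⟩
        rw [abs_mul, abs_of_pos hpos, ← hc, mul_assoc] at h2
        exact le_of_mul_le_mul_left h2 hpos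

end IsSSSI

/-- The path of `Y` on `[0,1]`. -/
def limitPath (Y : ℝ≥0 → Ω → ℝ)
    (hpath : ∀ ω, IsCadlag fun t => Y (unitInterval.toNNReal t) ω) (ω : Ω) : SkorokhodSpace :=
  ⟨fun t => Y (unitInterval.toNNReal t) ω, hpath ω⟩

/-- The bridge vanishes almost everywhere; if it were nonzero at some `t < 1`, right continuity
would keep it nonzero on an interval `[t, u)` of positive length. At `t = 1` there is nothing to
prove. -/
theorem SkorokhodSpace.bridgeSq_eq_zero {x : SkorokhodSpace}
    (hx : SkorokhodSpace.bridgeSq (fun s => s) x = 0) (t : unitInterval) :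
    x.toFun t = t * x.toFun 1 := by
  rcases eq_or_lt_of_le (unitInterval.le_one' (t := t)) with rfl | ht
  · simp
  obtain ⟨M, hM⟩ := x.isCadlag.exists_forall_abs_le
  have hint : Integrable (fun s : unitInterval => (x.toFun s - s * x.toFun 1) ^ 2) := by
    refine Integrable.of_bound ((x.isCadlag.aestronglyMeasurable.sub
      (measurable_subtype_coe.aestronglyMeasurable.mul_const _)).pow 2) ((2 * M) ^ 2)
      (ae_of_all _ fun s => ?_)
    rw [norm_pow, Real.norm_eq_abs]
    refine pow_le_pow_left₀ (abs_nonneg _) ?_ 2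
    have h1 : |(s : ℝ) * x.toFun 1| ≤ 1 * M := by
      rw [abs_mul, abs_of_nonneg s.2.1]
      exact mul_le_mul s.2.2 (hM 1) (abs_nonneg _) zero_le_one
    linarith [abs_sub (x.toFun s) (s * x.toFun 1), hM s]
  have hae := (integral_eq_zero_iff_of_nonneg (fun s => sq_nonneg _) hint).1 hx
  by_contra hne
  have hcont : ContinuousWithinAt (fun s : unitInterval => x.toFun s - s * x.toFun 1)
      (Set.Ici t) t := (x.isCadlag t).1.sub
    ((continuous_subtype_val.mul continuous_const).continuousWithinAt)
  have hev := hcont.eventually_ne (sub_ne_zero.2 hne)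
  obtain ⟨u, hu, hsub⟩ := (mem_nhdsGE_iff_exists_Ico_subset' ht).1 hev
  have hnull : volume (Set.Ico t u) = 0 := by
    refine measure_mono_null (fun s hs => ?_) (ae_iff.1 hae)
    exact fun h0 => hsub hs (by simpa using h0)
  rw [unitInterval.volume_Ico, ENNReal.ofReal_eq_zero] at hnull
  have : (t : ℝ) < u := hu
  linarith

/-- A vanishing bridge means `Y(s) = s Y(1)`. If `Y(1) = 0` the path is identically zero, otherwise
it is linear along `2^{-n}`; both have probability zero. -/
theorem ae_bridgeSq_limitPath_pos [IsProbabilityMeasure P] (hY : IsSSSI H Y P) (hH : H < 1)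
    (hpath : ∀ ω, IsCadlag fun t => Y (unitInterval.toNNReal t) ω)
    (hne : ∀ᵐ ω ∂P, ∃ t : unitInterval, Y (unitInterval.toNNReal t) ω ≠ 0) :
    ∀ᵐ ω ∂P, 0 < SkorokhodSpace.bridgeSq (fun s => s) (limitPath Y hpath ω) := by
  have hlin : ∀ᵐ ω ∂P, ¬ (Y 1 ω ≠ 0 ∧ ∀ n : ℕ, Y ((1 / 2) ^ n) ω = (1 / 2) ^ n * Y 1 ω) := by
    rw [ae_iff]
    simpa using hY.measure_linear_eq_zero hH
  filter_upwards [hne, hlin] with ω ⟨t, ht⟩ hω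
  refine lt_of_le_of_ne (integral_nonneg fun s => sq_nonneg _) fun h0 => hω ?_
  have hall := SkorokhodSpace.bridgeSq_eq_zero h0.symm
  simp only [limitPath, unitInterval.toNNReal_one] at hall
  refine ⟨fun h1 => ht ?_, fun n => ?_⟩
  · rw [hall t, h1, mul_zero]
  · have h2 := hall ⟨(1 / 2) ^ n, by positivity, pow_le_one₀ (by norm_num) (by norm_num)⟩
    have e : unitInterval.toNNReal ⟨(1 / 2) ^ n, by positivity,
        pow_le_one₀ (by norm_num) (by norm_num)⟩ = (1 / 2) ^ n := by
      ext; simp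
    rwa [e] at h2

/-- The integral is a limit of Riemann sums, each depending on finitely many coordinates of `Y`.
Convergence holds for every path since it is bounded and almost everywhere continuous. -/
theorem aemeasurable_bridgeSq_limitPath (hY : IsSSSI H Y P)
    (hpath : ∀ ω, IsCadlag fun t => Y (unitInterval.toNNReal t) ω) :
    AEMeasurable (fun ω => SkorokhodSpace.bridgeSq (fun s => s) (limitPath Y hpath ω)) P := by
  set g : ℕ → Ω → ℤ → ℝ := fun n ω k =>
    (Y (Real.toNNReal ((k : ℝ) / n)) ω - (k : ℝ) / n * Y 1 ω) ^ 2 with hg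
  refine aemeasurable_of_tendsto_metrizable_ae atTop
    (f := fun (n : ℕ) ω => ((n + 1 : ℕ) : ℝ)⁻¹ * ∑ k ∈ Finset.range (n + 1), g (n + 1) ω k)
    (fun n => ?_) (ae_of_all _ fun ω => ?_)
  · refine (Finset.aemeasurable_fun_sum _ fun k _ => ?_).const_mul _
    exact ((hY.aemeasurable _).sub ((hY.aemeasurable 1).const_mul _)).pow_const 2
  · simp only [← integral_comp_floor (g _ ω) (Nat.succ_pos _)]
    refine (tendsto_add_atTop_iff_nat 1
      (f := fun n : ℕ => ∫ s : unitInterval, g n ω ⌊(n : ℝ) * (s : ℝ)⌋)).2 ?_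
    obtain ⟨M, hM⟩ := (hpath ω).exists_forall_abs_le
    let q : ℕ → unitInterval → unitInterval := fun n s =>
      ⟨(⌊(n : ℝ) * (s : ℝ)⌋ : ℝ) / n, div_nonneg (by
        exact_mod_cast Int.floor_nonneg.2 (mul_nonneg n.cast_nonneg s.2.1)) n.cast_nonneg,
        (le_abs_self _).trans (abs_floor_div_le_one n s)⟩
    have hgq : ∀ n (s : unitInterval), g n ω ⌊(n : ℝ) * (s : ℝ)⌋ =
        (Y (unitInterval.toNNReal (q n s)) ω - (q n s : ℝ) * Y 1 ω) ^ 2 := by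
      intro n s
      have : Real.toNNReal ((⌊(n : ℝ) * (s : ℝ)⌋ : ℝ) / n) = unitInterval.toNNReal (q n s) := by
        ext
        rw [Real.coe_toNNReal _ (q n s).2.1, unitInterval.coe_toNNReal]
      simp only [hg, this]
      rfl
    have hqt : ∀ s, Tendsto (fun n => q n s) atTop (𝓝 s) := fun s =>
      tendsto_subtype_rng.2 (tendsto_floor_div s)
    refine tendsto_integral_of_dominated_convergence (fun _ => (2 * M) ^ 2) (fun n => ?_)
      (integrable_const _) (fun n => ae_of_all _ fun s => ?_) ?_
    · have : Measurable fun s : unitInterval => g n ω ⌊(n : ℝ) * (s : ℝ)⌋ :=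
        (measurable_from_top (f := g n ω)).comp (by fun_prop)
      exact this.aestronglyMeasurable
    · rw [hgq, norm_pow, Real.norm_eq_abs]
      refine pow_le_pow_left₀ (abs_nonneg _) ?_ 2
      have hM1 := hM 1
      rw [unitInterval.toNNReal_one] at hM1
      have h1 : |(q n s : ℝ) * Y 1 ω| ≤ 1 * M := by
        rw [abs_mul, abs_of_nonneg (q n s).2.1]
        exact mul_le_mul (q n s).2.2 hM1 (abs_nonneg _) zero_le_one
      linarith [abs_sub (Y (unitInterval.toNNReal (q n s)) ω) (q n s * Y 1 ω), hM (q n s)]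
    · filter_upwards [(hpath ω).ae_continuousAt] with s hs
      simp only [hgq]
      exact ((hs.tendsto.comp (hqt s)).sub
        (((continuous_subtype_val.tendsto s).comp (hqt s)).mul_const _)).pow 2

end LimitProcess


/-! ### Averages over blocks of a stationary Gaussian process -/

section BlockAverage

variable {Ω : Type*} [MeasurableSpace Ω] {P : Measure Ω} {J : ℕ}
  {Z : ℤ → Ω → Fin J → ℝ}

theorem hasGaussianLaw_blocks [IsProbabilityMeasure P] (hZ : IsGaussianProcess Z P) (k m : ℕ) :
    HasGaussianLaw (fun ω s => (Sum.elim (block Z 1 m) (block Z ((k : ℤ) + 1) m) :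
      (Fin m × Fin J) ⊕ (Fin m × Fin J) → Ω → ℝ) s ω) P := by
  set I : Finset ℤ := Finset.Icc 1 ((k : ℤ) + m)
  have h1 : ∀ p : Fin m, 1 + ((p : ℕ) : ℤ) ∈ I := fun p => by
    have := p.2; simp only [I, Finset.mem_Icc]; omega
  have h2 : ∀ p : Fin m, (k : ℤ) + 1 + ((p : ℕ) : ℤ) ∈ I := fun p => by
    have := p.2; simp only [I, Finset.mem_Icc]; omega
  let pr : I → Fin J → ((I → Fin J → ℝ) →L[ℝ] ℝ) := fun i j =>
    (ContinuousLinearMap.proj (R := ℝ) (φ := fun _ : Fin J => ℝ) j).comp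
      (ContinuousLinearMap.proj (R := ℝ) (φ := fun _ : I => Fin J → ℝ) i)
  let L : (I → Fin J → ℝ) →L[ℝ] ((Fin m × Fin J) ⊕ (Fin m × Fin J) → ℝ) :=
    ContinuousLinearMap.pi fun s => Sum.elim (fun p => pr ⟨_, h1 p.1⟩ p.2)
      (fun p => pr ⟨_, h2 p.1⟩ p.2) s
  have e : (fun ω s => (Sum.elim (block Z 1 m) (block Z ((k : ℤ) + 1) m) :
      (Fin m × Fin J) ⊕ (Fin m × Fin J) → Ω → ℝ) s ω) = fun ω => L (I.restrict (Z · ω)) := by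
    funext ω s
    rcases s with p | p <;> rfl
  rw [e]
  exact (hZ.hasGaussianLaw I).map_fun L

theorem identDistrib_block (hZ : IsStationary Z P) (s : ℤ) (m : ℕ) :
    IdentDistrib (fun ω p => block Z s m p ω) (fun ω p => block Z 1 m p ω) P P := by
  have h := (hZ (s - 1)).comp (u := fun z : ℤ → Fin J → ℝ => fun p : Fin m × Fin J =>
    z (1 + ((p.1 : ℕ) : ℤ)) p.2) (by fun_prop)
  have e : ∀ p : Fin m, 1 + ((p : ℕ) : ℤ) + (s - 1) = s + ((p : ℕ) : ℤ) := fun p => by ring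
  simp only [Function.comp_def, e] at h
  exact h

theorem identDistrib_block_pair (hZ : IsStationary Z P) (s : ℤ) (k m : ℕ) :
    IdentDistrib (fun ω => ((fun p => block Z s m p ω), (fun p => block Z (s + k) m p ω)))
      (fun ω => ((fun p => block Z 1 m p ω), (fun p => block Z ((k : ℤ) + 1) m p ω))) P P := by
  have h := (hZ (s - 1)).comp (u := fun z : ℤ → Fin J → ℝ =>
    ((fun p : Fin m × Fin J => z (1 + ((p.1 : ℕ) : ℤ)) p.2),
      (fun p : Fin m × Fin J => z ((k : ℤ) + 1 + ((p.1 : ℕ) : ℤ)) p.2))) (by fun_prop)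
  have e : ∀ p : Fin m, 1 + ((p : ℕ) : ℤ) + (s - 1) = s + ((p : ℕ) : ℤ) := fun p => by ring
  have e' : ∀ p : Fin m, (k : ℤ) + 1 + ((p : ℕ) : ℤ) + (s - 1) = s + k + ((p : ℕ) : ℤ) :=
    fun p => by ring
  simp only [Function.comp_def, e, e'] at h
  exact h

theorem blockCorr_nonneg (k m : ℕ) : 0 ≤ blockCorr Z P k m :=
  Real.iSup_nonneg fun _ => abs_nonneg _

theorem abs_covariance_block_le [IsProbabilityMeasure P] (hZ_gauss : IsGaussianProcess Z P)
    (hZ_stat : IsStationary Z P)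
    (hZ_mean : ∀ i j, ∫ ω, Z i ω j ∂P = 0) {m : ℕ} {f : (Fin m × Fin J → ℝ) → ℝ}
    (hf : Measurable f) (hf01 : ∀ v, f v ∈ Set.Icc (0 : ℝ) 1) (s t : ℤ) :
    |cov[fun ω => f fun p => block Z s m p ω, fun ω => f fun p => block Z t m p ω; P]| ≤
      2 * blockCorr Z P (s - t).natAbs m := by
  wlog hst : s ≤ t generalizing s t
  · rw [covariance_comm, ← Int.natAbs_neg, neg_sub]
    exact this t s (by omega)
  obtain ⟨k, rfl⟩ := Int.le.dest hst
  have h := covariance_comp_eq_of_identDistrib (identDistrib_block_pair hZ_stat s k m)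
    (f := fun v => f v.1) (g := fun v => f v.2) (hf.comp measurable_fst) (hf.comp measurable_snd)
  have e : (s - (s + (k : ℤ))).natAbs = k := by omega
  rw [h, e]
  exact abs_covariance_le_two_mul_canonicalCorr (hasGaussianLaw_blocks hZ_gauss k m)
    (fun p => hZ_mean _ _) (fun p => hZ_mean _ _) hf hf hf01 hf01

/-- Each lag `k` occurs for at most the two indices `i - k` and `i + k`. -/
theorem sum_natAbs_sub_le {f : ℕ → ℝ} (hf : ∀ k, 0 ≤ f k) (N : ℕ) {i : ℤ}
    (hi : i ∈ Finset.Icc (1 : ℤ) N) :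
    ∑ j ∈ Finset.Icc (1 : ℤ) N, f (i - j).natAbs ≤ 2 * ∑ k ∈ Finset.range (N + 1), f k := by
  rw [Finset.mem_Icc] at hi
  rw [← Finset.sum_fiberwise_of_maps_to (s := Finset.Icc (1 : ℤ) N) (t := Finset.range (N + 1))
    (g := fun j => (i - j).natAbs) (fun j hj => by
      rw [Finset.mem_Icc] at hj; rw [Finset.mem_range]; omega), Finset.mul_sum]
  refine Finset.sum_le_sum fun k _ => ?_
  rw [Finset.sum_congr rfl fun j hj => by rw [(Finset.mem_filter.1 hj).2], Finset.sum_const,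
    nsmul_eq_mul]
  refine mul_le_mul_of_nonneg_right ?_ (hf k)
  have hsub : (Finset.Icc (1 : ℤ) N).filter (fun j => (i - j).natAbs = k) ⊆
      {i - (k : ℤ), i + (k : ℤ)} := by
    intro j hj
    have := (Finset.mem_filter.1 hj).2
    simp only [Finset.mem_insert, Finset.mem_singleton]
    omega
  exact_mod_cast (Finset.card_le_card hsub).trans Finset.card_le_two

/-- A weak law of large numbers for averages over blocks. -/
theorem measureReal_block_average_le [IsProbabilityMeasure P] (hZ_gauss : IsGaussianProcess Z P)
    (hZ_stat : IsStationary Z P) (hZ_mean : ∀ i j, ∫ ω, Z i ω j ∂P = 0) {m : ℕ}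
    {f : (Fin m × Fin J → ℝ) → ℝ} (hf : Measurable f) (hf01 : ∀ v, f v ∈ Set.Icc (0 : ℝ) 1)
    (l : ℤ) {N : ℕ} (hN : 0 < N) {ε : ℝ} (hε : 0 < ε) :
    P.real {ω | (∫ ω', f (fun p => block Z 1 m p ω') ∂P) + ε ≤
      (N : ℝ)⁻¹ * ∑ i ∈ Finset.Icc (1 : ℤ) N, f fun p => block Z (i - l) m p ω} ≤
      4 * (N : ℝ)⁻¹ * (∑ k ∈ Finset.range (N + 1), blockCorr Z P k m) / ε ^ 2 := by
  have hN' : (0 : ℝ) < N := by exact_mod_cast hN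
  set W : ℤ → Ω → ℝ := fun i ω => f fun p => block Z (i - l) m p ω with hW
  have hid : ∀ i, IdentDistrib (W i) (fun ω => f fun p => block Z 1 m p ω) P P := fun i =>
    (identDistrib_block hZ_stat (i - l) m).comp hf
  have hWm : ∀ i, AEMeasurable (W i) P := fun i => (hid i).aemeasurable_fst
  have hW2 : ∀ i, MemLp (W i) 2 P := fun i => memLp_two_of_mem_Icc (hWm i) fun ω => hf01 _
  set A : Ω → ℝ := fun ω => (N : ℝ)⁻¹ * ∑ i ∈ Finset.Icc (1 : ℤ) N, W i ω with hA
  have hS2 : MemLp (fun ω => ∑ i ∈ Finset.Icc (1 : ℤ) N, W i ω) 2 P :=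
    memLp_finsetSum _ fun i _ => hW2 i
  have hA2 : MemLp A 2 P := hS2.const_mul _
  have hmean : ∫ ω, A ω ∂P = ∫ ω, f (fun p => block Z 1 m p ω) ∂P := by
    rw [hA, integral_const_mul, integral_finsetSum _ fun i _ => (hW2 i).integrable (by norm_num)]
    simp only [(hid _).integral_eq, Finset.sum_const, Int.card_Icc, nsmul_eq_mul]
    simp [hN'.ne']
  -- The constant `4` is `2` from the covariance bound times `2` for the two signs of a lag.
  have hvarS : Var[fun ω => ∑ i ∈ Finset.Icc (1 : ℤ) N, W i ω; P] ≤
      4 * N * ∑ k ∈ Finset.range (N + 1), blockCorr Z P k m := by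
    rw [variance_fun_sum' fun i _ => hW2 i]
    calc ∑ i ∈ Finset.Icc (1 : ℤ) N, ∑ j ∈ Finset.Icc (1 : ℤ) N, cov[W i, W j; P]
        ≤ ∑ i ∈ Finset.Icc (1 : ℤ) N, 2 *
            (2 * ∑ k ∈ Finset.range (N + 1), blockCorr Z P k m) := by
          refine Finset.sum_le_sum fun i hi => ?_
          calc ∑ j ∈ Finset.Icc (1 : ℤ) N, cov[W i, W j; P]
              ≤ ∑ j ∈ Finset.Icc (1 : ℤ) N, 2 * blockCorr Z P (i - j).natAbs m := by
                refine Finset.sum_le_sum fun j _ => ?_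
                have h := abs_covariance_block_le hZ_gauss hZ_stat hZ_mean hf hf01
                  (i - l) (j - l)
                rw [sub_sub_sub_cancel_right] at h
                exact (le_abs_self _).trans h
            _ ≤ _ := by
                rw [← Finset.mul_sum]
                exact mul_le_mul_of_nonneg_left
                  (sum_natAbs_sub_le (fun k => blockCorr_nonneg k m) N hi) two_pos.le
      _ = _ := by
          rw [Finset.sum_const, Int.card_Icc, nsmul_eq_mul]
          simp
          ring
  have hvar : Var[A; P] ≤ 4 * (N : ℝ)⁻¹ * ∑ k ∈ Finset.range (N + 1), blockCorr Z P k m := by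
    rw [hA, variance_const_mul]
    calc (N : ℝ)⁻¹ ^ 2 * Var[fun ω => ∑ i ∈ Finset.Icc (1 : ℤ) N, W i ω; P]
        ≤ (N : ℝ)⁻¹ ^ 2 * (4 * N * ∑ k ∈ Finset.range (N + 1), blockCorr Z P k m) := by gcongr
      _ = _ := by field_simp
  have hcheb := meas_ge_le_variance_div_sq hA2 hε
  rw [hmean] at hcheb
  refine ENNReal.toReal_le_of_le_ofReal ?_ ((measure_mono fun ω hω => ?_).trans
    (hcheb.trans (ENNReal.ofReal_le_ofReal ?_)))
  · have : 0 ≤ ∑ k ∈ Finset.range (N + 1), blockCorr Z P k m :=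
      Finset.sum_nonneg fun k _ => blockCorr_nonneg k m
    positivity
  · have hω' : (∫ ω', f (fun p => block Z 1 m p ω') ∂P) + ε ≤ A ω := hω
    change ε ≤ |A ω - _|
    exact (by linarith : ε ≤ A ω - _).trans (le_abs_self _)
  · gcongr

end BlockAverage

/-! ### Block statistics as functions of blocks -/

section BlockStatistics

variable {Ω Ω' : Type*}

/-- The self-normalized block statistic centered at the true mean. -/
noncomputable def centeredStat (X : ℤ → Ω → ℝ) (mu : ℝ) (b : ℕ) (i : ℤ) (ω : Ω) : ℝ :=
  (partialSum X i (i + b - 1) ω - b * mu) / blockNormalizer X i b ω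

/-- The two processes may live on different spaces, so that block statistics can be compared with
functions of a deterministic block vector. -/
theorem partialSum_shift {X : ℤ → Ω → ℝ} {X' : ℤ → Ω' → ℝ} {ω : Ω} {ω' : Ω'} {i k : ℤ} (d : ℤ)
    (h : ∀ j ∈ Finset.Icc i k, X j ω = X' (j + d) ω') :
    partialSum X i k ω = partialSum X' (i + d) (k + d) ω' := by
  refine Finset.sum_nbij' (· + d) (· - d) ?_ ?_ (by simp) (by simp) h <;>
  · intro j hj
    simp only [Finset.mem_Icc] at hj ⊢
    omega

theorem blockNormalizer_shift {X : ℤ → Ω → ℝ} {X' : ℤ → Ω' → ℝ} {ω : Ω} {ω' : Ω'} {i : ℤ} {b : ℕ}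
    (d : ℤ) (h : ∀ j ∈ Finset.Icc i (i + b - 1), X j ω = X' (j + d) ω') :
    blockNormalizer X i b ω = blockNormalizer X' (i + d) b ω' := by
  unfold blockNormalizer
  congr 2
  refine Finset.sum_nbij' (· + d) (· - d) ?_ ?_ (by simp) (by simp) fun k hk => ?_
  · intro k hk; simp only [Finset.mem_Icc] at hk ⊢; omega
  · intro k hk; simp only [Finset.mem_Icc] at hk ⊢; omega
  · rw [Finset.mem_Icc] at hk
    rw [partialSum_shift d h, partialSum_shift d fun j hj => h j (by
      rw [Finset.mem_Icc] at hj ⊢; omega)]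
    push_cast
    ring_nf

theorem centeredStat_shift {X : ℤ → Ω → ℝ} {X' : ℤ → Ω' → ℝ} {ω : Ω} {ω' : Ω'} {i : ℤ} {b : ℕ}
    (mu : ℝ) (d : ℤ) (h : ∀ j ∈ Finset.Icc i (i + b - 1), X j ω = X' (j + d) ω') :
    centeredStat X mu b i ω = centeredStat X' mu b (i + d) ω' := by
  rw [centeredStat, centeredStat, blockNormalizer_shift d h, partialSum_shift d h]
  ring_nf

theorem measurable_partialSum [MeasurableSpace Ω] {X : ℤ → Ω → ℝ} (hX : ∀ i, Measurable (X i))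
    (i k : ℤ) :
    Measurable (partialSum X i k) :=
  Finset.measurable_fun_sum _ fun j _ => hX j

theorem measurable_blockNormalizer [MeasurableSpace Ω] {X : ℤ → Ω → ℝ} (hX : ∀ i, Measurable (X i))
    (i : ℤ) (b : ℕ) :
    Measurable (blockNormalizer X i b) := by
  refine Measurable.sqrt (Measurable.const_mul (Finset.measurable_fun_sum _ fun k _ => ?_) _)
  exact ((measurable_partialSum hX _ _).sub
    ((measurable_partialSum hX _ _).const_mul _)).pow_const 2

theorem measurable_centeredStat [MeasurableSpace Ω] {X : ℤ → Ω → ℝ} (hX : ∀ i, Measurable (X i))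
    (mu : ℝ) (b : ℕ) (i : ℤ) : Measurable (centeredStat X mu b i) :=
  ((measurable_partialSum hX _ _).sub_const _).div (measurable_blockNormalizer hX i b)

/-- The variables `X_i, …, X_{i+b-1}`, numbered from `1` to `b`, as functions of the block
`Z_{i-l}, …, Z_{i+b-1}`. -/
noncomputable def blockProcess {J l : ℕ} (G : (Fin (l + 1) → Fin J → ℝ) → ℝ) (b : ℕ) (c : ℤ)
    (v : Fin (l + b) × Fin J → ℝ) : ℝ :=
  -- For `c` between `1` and `b` the index lies between `0` and `l + b - 1`; the truncation of
  -- `toNat` and the default value `0` only concern other `c`.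
  G fun a j => if h : (l + c - 1 - (a : ℕ)).toNat < l + b then
    v (⟨(l + c - 1 - (a : ℕ)).toNat, h⟩, j) else 0

theorem measurable_blockProcess {J l : ℕ} {G : (Fin (l + 1) → Fin J → ℝ) → ℝ} (hG : Measurable G)
    (b : ℕ) (c : ℤ) : Measurable (blockProcess G b c) := by
  refine hG.comp (measurable_pi_lambda _ fun a => measurable_pi_lambda _ fun j => ?_)
  split_ifs
  · exact measurable_pi_apply _
  · exact measurable_const

theorem eq_blockProcess {J l : ℕ} {G : (Fin (l + 1) → Fin J → ℝ) → ℝ}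
    {Z : ℤ → Ω → Fin J → ℝ} {X : ℤ → Ω → ℝ}
    (hX : ∀ i ω, X i ω = G fun a => Z (i - ((a : ℕ) : ℤ)) ω) {b : ℕ} {i : ℤ} (ω : Ω) :
    ∀ j ∈ Finset.Icc i (i + b - 1),
      X j ω = blockProcess G b (j + (1 - i)) fun p => block Z (i - l) (l + b) p ω := by
  intro j hj
  rw [Finset.mem_Icc] at hj
  rw [hX, blockProcess]
  congr 1
  ext a c
  have ha := a.2
  rw [dif_pos (by omega), block]
  congr 2
  simp only
  omega

end BlockStatistics


/-! ### Tails of a single random variable -/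

theorem exists_pos_measureReal_le_lt {Ω : Type*} [MeasurableSpace Ω] {P : Measure Ω}
    [IsProbabilityMeasure P] {W : Ω → ℝ} (hW : AEMeasurable W P) (hpos : ∀ᵐ ω ∂P, 0 < W ω)
    {η : ℝ} (hη : 0 < η) : ∃ c > 0, P.real {ω | W ω ≤ c} < η := by
  have hlim := tendsto_measure_iInter_atTop (μ := P)
    (s := fun n : ℕ => {ω | W ω ≤ 1 / ((n : ℝ) + 1)})
    (fun n => hW.nullMeasurable (s := Set.Iic _) measurableSet_Iic)
    (fun m n hmn ω (hω : W ω ≤ _) => hω.trans (one_div_le_one_div_of_le (by positivity)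
      (by gcongr))) ⟨0, measure_ne_top _ _⟩
  have h0 : P (⋂ n : ℕ, {ω | W ω ≤ 1 / ((n : ℝ) + 1)}) = 0 := by
    refine measure_mono_null (fun ω hω => ?_) (ae_iff.1 hpos)
    have hω := Set.mem_iInter.1 hω
    exact not_lt.2 (ge_of_tendsto' tendsto_one_div_add_atTop_nhds_zero_nat hω)
  rw [h0] at hlim
  obtain ⟨n, hn⟩ := (hlim.eventually_lt_const (ENNReal.ofReal_pos.2 hη)).exists
  exact ⟨1 / ((n : ℝ) + 1), by positivity,
    (ENNReal.lt_ofReal_iff_toReal_lt (measure_ne_top _ _)).1 hn⟩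

theorem exists_measureReal_abs_ge_lt {Ω : Type*} [MeasurableSpace Ω] {P : Measure Ω}
    [IsProbabilityMeasure P] {W : Ω → ℝ} (hW : AEMeasurable W P)
    {η : ℝ} (hη : 0 < η) : ∃ K > 0, P.real {ω | K ≤ |W ω|} < η := by
  -- Large values of `|W|` are small values of the positive variable `1/(1 + |W|)`.
  obtain ⟨c, hc, h⟩ := exists_pos_measureReal_le_lt (W := fun ω => (1 + |W ω|)⁻¹) (P := P)
    ((hW.norm.const_add 1).inv) (ae_of_all _ fun ω => by positivity) hη
  refine ⟨c⁻¹, by positivity, lt_of_le_of_lt (measureReal_mono fun ω hω => ?_) h⟩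
  have hω' : c⁻¹ ≤ |W ω| := hω
  exact inv_le_of_inv_le₀ hc (hω'.trans (by linarith))

/-! ### The normalized partial sums and the block statistics -/

section PartialSums

variable {Ω : Type*} {X : ℤ → Ω → ℝ} {mu H : ℝ} {ℓ : ℝ → ℝ}

theorem partialSumPath_one (n : ℕ) (ω : Ω) : (partialSumPath X mu H ℓ n ω).toFun 1 =
    (partialSum X 1 n ω - n * mu) / ((n : ℝ) ^ H * ℓ n) := by
  simp [partialSumPath]

theorem sum_Icc_int_eq_sum_range (f : ℤ → ℝ) (n : ℕ) :
    ∑ k ∈ Finset.Icc (1 : ℤ) n, f k = ∑ k ∈ Finset.range n, f (k + 1) := by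
  refine Finset.sum_nbij' (fun k => (k - 1).toNat) (fun k => (k : ℤ) + 1) ?_ ?_ ?_ ?_ ?_
  · intro k hk; simp only [Finset.mem_Icc, Finset.mem_range] at hk ⊢; omega
  · intro k hk; simp only [Finset.mem_Icc, Finset.mem_range] at hk ⊢; omega
  · intro k hk; simp only [Finset.mem_Icc] at hk; omega
  · intro k hk; omega
  · intro k hk
    simp only [Finset.mem_Icc] at hk
    congr 1; omega

theorem sqrt_bridgeSq_partialSumPath {n : ℕ} (hn : 0 < n) (ha : 0 < (n : ℝ) ^ H * ℓ n) (ω : Ω) :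
    √(SkorokhodSpace.bridgeSq (fun s => (⌊(n : ℝ) * (s : ℝ)⌋ : ℝ) / n)
      (partialSumPath X mu H ℓ n ω)) = blockNormalizer X 1 n ω / ((n : ℝ) ^ H * ℓ n) := by
  have hn' : (n : ℝ) ≠ 0 := by positivity
  set a := (n : ℝ) ^ H * ℓ n with ha_def
  set g : ℤ → ℝ := fun k =>
    (partialSum X 1 k ω - (n : ℝ)⁻¹ * k * partialSum X 1 n ω) ^ 2 with hg
  have hint : SkorokhodSpace.bridgeSq (fun s => (⌊(n : ℝ) * (s : ℝ)⌋ : ℝ) / n)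
      (partialSumPath X mu H ℓ n ω) = ∫ s : unitInterval, g ⌊(n : ℝ) * (s : ℝ)⌋ / a ^ 2 := by
    unfold SkorokhodSpace.bridgeSq
    refine integral_congr_ae (ae_of_all _ fun s => ?_)
    beta_reduce
    rw [partialSumPath_one]
    simp only [partialSumPath, hg]
    rw [← ha_def]
    field_simp
    ring
  -- The integral yields the indices `0, …, n-1` and the normalizer uses `1, …, n`; the discrete
  -- bridge vanishes at both `0` and `n`.
  have hsum : ∑ k ∈ Finset.range n, g k = ∑ k ∈ Finset.Icc (1 : ℤ) n, g k := by
    rw [sum_Icc_int_eq_sum_range]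
    have h1 := Finset.sum_range_succ (fun k : ℕ => g k) n
    have h2 := Finset.sum_range_succ' (fun k : ℕ => g k) n
    have h3 : g (n : ℕ) = 0 := by simp [hg, hn']
    have h4 : g ((0 : ℕ) : ℤ) = 0 := by simp [hg, partialSum]
    rw [h3, add_zero] at h1
    rw [h4, add_zero] at h2
    push_cast at h2
    rw [← h1, h2]
  rw [hint, integral_div, integral_comp_floor g hn, hsum, Real.sqrt_div' _ (sq_nonneg a),
    Real.sqrt_sq ha.le, blockNormalizer]
  congr 3
  have e : (1 : ℤ) + n - 1 = n := by ring
  rw [e]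
  refine Finset.sum_congr rfl fun k _ => ?_
  simp [hg]

/-- The self-normalized statistic of a path. -/
noncomputable def pathStat (r : unitInterval → ℝ) (y : SkorokhodSpace) : ℝ :=
  y.toFun 1 / √(y.bridgeSq r)

theorem pathStat_partialSumPath {n : ℕ} (hn : 0 < n) (ha : 0 < (n : ℝ) ^ H * ℓ n) (ω : Ω) :
    pathStat (fun s => (⌊(n : ℝ) * (s : ℝ)⌋ : ℝ) / n) (partialSumPath X mu H ℓ n ω) =
      centeredStat X mu n 1 ω := by
  rw [pathStat, sqrt_bridgeSq_partialSumPath hn ha, partialSumPath_one,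
    div_div_div_cancel_right₀ ha.ne', centeredStat]
  congr 3
  ring_nf

theorem pathStat_limitPath {Y : ℝ≥0 → Ω → ℝ}
    (hpath : ∀ ω, IsCadlag fun t => Y (unitInterval.toNNReal t) ω) (ω : Ω) :
    pathStat (fun s => s) (limitPath Y hpath ω) = limitStat Y ω := by
  simp [pathStat, limitPath, limitStat, SkorokhodSpace.bridgeSq]

/-- The two statistics differ by `-b(X̄_n - μ)/D_{i,b}`, so one bound on the sample mean controls
all blocks with normalizer at least `d` simultaneously. -/
theorem abs_blockStat_sub_centeredStat_le {n b : ℕ} {i : ℤ} {ω : Ω} {d ε : ℝ} (hd : 0 < d)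
    (hD : d ≤ blockNormalizer X i b ω) (hε : |b * (sampleMean X n ω - mu)| ≤ ε * d) :
    |blockStat X n b i ω - centeredStat X mu b i ω| ≤ ε := by
  have hDpos := hd.trans_le hD
  have e : blockStat X n b i ω - centeredStat X mu b i ω =
      -(b * (sampleMean X n ω - mu)) / blockNormalizer X i b ω := by
    rw [blockStat, centeredStat]; ring
  rw [e, abs_div, abs_neg, abs_of_pos hDpos, div_le_iff₀ hDpos]
  have hε0 : 0 ≤ ε := by
    by_contra hneg
    have := (abs_nonneg _).trans hε
    nlinarith
  exact hε.trans (mul_le_mul_of_nonneg_left hD hε0)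

end PartialSums

theorem aemeasurable_limitStat {Ω : Type*} [MeasurableSpace Ω] {P : Measure Ω} {H : ℝ}
    {Y : ℝ≥0 → Ω → ℝ} (hY : IsSSSI H Y P)
    (hpath : ∀ ω, IsCadlag fun t => Y (unitInterval.toNNReal t) ω) :
    AEMeasurable (limitStat Y) P := by
  have h := (hY.aemeasurable 1).div (aemeasurable_bridgeSq_limitPath hY hpath).sqrt
  refine h.congr (ae_of_all _ fun ω => ?_)
  simp [limitPath, limitStat, SkorokhodSpace.bridgeSq]

/-! ### Limits of functionals of the partial sum process -/

section WeakLimits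

variable {Ω Ω' : Type*} [MeasurableSpace Ω] [MeasurableSpace Ω'] {P : Measure Ω}
  [IsProbabilityMeasure P] {P' : Measure Ω'} [IsProbabilityMeasure P'] {X : ℤ → Ω → ℝ}
  {mu H : ℝ} {ℓ : ℝ → ℝ} {Y : ℝ≥0 → Ω' → ℝ}

theorem IsSlowlyVarying.eventually_scale_pos (hℓ : IsSlowlyVarying ℓ) (H : ℝ) :
    ∀ᶠ n : ℕ in atTop, 0 < n ∧ 0 < (n : ℝ) ^ H * ℓ n := by
  filter_upwards [eventually_gt_atTop 0,
    tendsto_natCast_atTop_atTop.eventually hℓ.eventually_pos] with n hn hℓn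
  exact ⟨hn, by positivity⟩

theorem ae_continuousAt_limitPath (hY : IsSSSI H Y P')
    (hpath : ∀ ω, IsCadlag fun t => Y (unitInterval.toNNReal t) ω) :
    ∀ᵐ ω ∂P', ContinuousAt (limitPath Y hpath ω).toFun 1 := by
  filter_upwards [hY.ae_leftLim_one hpath] with ω hω
  exact (hpath ω).continuousAt_of_leftLim_eq hω

theorem eventually_measureReal_sum_mem_lt (hY : IsSSSI H Y P')
    (hpath : ∀ ω, IsCadlag fun t => Y (unitInterval.toNNReal t) ω)
    (hconv : TendstoInDistribution (fun n : ℕ => partialSumPath X mu H ℓ n) atTop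
      (limitPath Y hpath) (fun _ => P) P') {C : Set ℝ} (hC : IsClosed C) {c : ℝ}
    (hc : P'.real {ω | Y 1 ω ∈ C} < c) :
    ∀ᶠ n : ℕ in atTop,
      P.real {ω | (partialSum X 1 n ω - n * mu) / ((n : ℝ) ^ H * ℓ n) ∈ C} < c := by
  have h := eventually_measureReal_preimage_closed_lt hconv (h := fun _ y => y.toFun 1)
    (h' := fun y => y.toFun 1) ?_ hC (by simpa [limitPath] using hc)
  · simpa only [partialSumPath_one] using h
  · filter_upwards [ae_continuousAt_limitPath hY hpath] with ω hω
    exact (SkorokhodSpace.tendsto_eval hω).comp tendsto_snd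

theorem eventually_measureReal_blockNormalizer_le_lt (hY : IsSSSI H Y P')
    (hℓ : IsSlowlyVarying ℓ)
    (hpath : ∀ ω, IsCadlag fun t => Y (unitInterval.toNNReal t) ω)
    (hconv : TendstoInDistribution (fun n : ℕ => partialSumPath X mu H ℓ n) atTop
      (limitPath Y hpath) (fun _ => P) P') {d c : ℝ}
    (hc : P'.real {ω | √(SkorokhodSpace.bridgeSq (fun s => s) (limitPath Y hpath ω)) ≤ d} < c) :
    ∀ᶠ n : ℕ in atTop,
      P.real {ω | blockNormalizer X 1 n ω ≤ d * ((n : ℝ) ^ H * ℓ n)} < c := by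
  have h := eventually_measureReal_preimage_closed_lt hconv
    (h := fun n y => √(y.bridgeSq fun s => (⌊(n : ℝ) * (s : ℝ)⌋ : ℝ) / n))
    (h' := fun y => √(y.bridgeSq fun s => s)) ?_ (isClosed_Iic (a := d)) hc
  · filter_upwards [h, hℓ.eventually_scale_pos H] with n hn ⟨h0, ha⟩
    simpa only [sqrt_bridgeSq_partialSumPath h0 ha, Set.mem_Iic, div_le_iff₀ ha] using hn
  · filter_upwards [ae_continuousAt_limitPath hY hpath] with ω hω
    exact (SkorokhodSpace.tendsto_bridgeSq hω measurable_floor_div abs_floor_div_le_one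
      fun s => tendsto_floor_div s).sqrt

/-- The quotient is continuous at almost every limit path because its numerator is continuous when
there is no jump at `1` and its denominator is then continuous with a positive limit. -/
theorem eventually_measureReal_centeredStat_mem_lt (hY : IsSSSI H Y P') (hH : H < 1)
    (hℓ : IsSlowlyVarying ℓ)
    (hpath : ∀ ω, IsCadlag fun t => Y (unitInterval.toNNReal t) ω)
    (hne : ∀ᵐ ω ∂P', ∃ t : unitInterval, Y (unitInterval.toNNReal t) ω ≠ 0)
    (hconv : TendstoInDistribution (fun n : ℕ => partialSumPath X mu H ℓ n) atTop
      (limitPath Y hpath) (fun _ => P) P') {C : Set ℝ} (hC : IsClosed C) {c : ℝ}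
    (hc : P'.real {ω | limitStat Y ω ∈ C} < c) :
    ∀ᶠ n : ℕ in atTop, P.real {ω | centeredStat X mu n 1 ω ∈ C} < c := by
  have h := eventually_measureReal_preimage_closed_lt hconv
    (h := fun n => pathStat fun s => (⌊(n : ℝ) * (s : ℝ)⌋ : ℝ) / n)
    (h' := pathStat fun s => s) ?_ hC (by simpa only [pathStat_limitPath] using hc)
  · filter_upwards [h, hℓ.eventually_scale_pos H] with n hn ⟨h0, ha⟩
    simpa only [pathStat_partialSumPath h0 ha] using hn
  · filter_upwards [ae_continuousAt_limitPath hY hpath,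
      ae_bridgeSq_limitPath_pos hY hH hpath hne] with ω hω hpos
    exact ((SkorokhodSpace.tendsto_eval hω).comp tendsto_snd).div
      (SkorokhodSpace.tendsto_bridgeSq hω measurable_floor_div abs_floor_div_le_one
        fun s => tendsto_floor_div s).sqrt (Real.sqrt_pos.2 hpos).ne'

/-- The sample mean converges fast enough to replace the true mean in the block statistics. -/
theorem eventually_measureReal_sampleMean_lt (hY : IsSSSI H Y P') (hH : H < 1)
    (hℓ : IsSlowlyVarying ℓ)
    (hpath : ∀ ω, IsCadlag fun t => Y (unitInterval.toNNReal t) ω)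
    (hconv : TendstoInDistribution (fun n : ℕ => partialSumPath X mu H ℓ n) atTop
      (limitPath Y hpath) (fun _ => P) P') {b : ℕ → ℕ} (hb_top : Tendsto b atTop atTop)
    (hb_o : (fun n => (b n : ℝ)) =o[atTop] fun n : ℕ => (n : ℝ)) {ε δ : ℝ} (hε : 0 < ε)
    (hδ : 0 < δ) :
    ∀ᶠ n in atTop, P.real {ω | ε * ((b n : ℝ) ^ H * ℓ (b n)) <
      |b n * (sampleMean X n ω - mu)|} < δ := by
  obtain ⟨K, hK, hYK⟩ := exists_measureReal_abs_ge_lt (hY.aemeasurable 1) hδ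
  have h1 := eventually_measureReal_sum_mem_lt (C := {y | K ≤ |y|}) hY hpath hconv
    (isClosed_le continuous_const continuous_abs) hYK
  -- With normalized total sum below `K`, a scale factor below `ε/K` keeps the error under `ε a_b`.
  have hκ := (hℓ.tendsto_div_mul_scale_div_scale hH hb_top hb_o).eventually_lt_const
    (div_pos hε hK)
  filter_upwards [h1, hκ, hℓ.eventually_scale_pos H,
    hb_top.eventually (hℓ.eventually_scale_pos H)] with n hn hκn ⟨hn0, ha⟩ ⟨hb0, hab⟩
  refine lt_of_le_of_lt (measureReal_mono fun ω hω => ?_) hn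
  have hω' : ε * ((b n : ℝ) ^ H * ℓ (b n)) < |b n * (sampleMean X n ω - mu)| := hω
  by_contra hlt
  have hlt' : |(partialSum X 1 n ω - n * mu) / ((n : ℝ) ^ H * ℓ n)| < K := not_le.1 hlt
  set a := (n : ℝ) ^ H * ℓ n
  set a' := (b n : ℝ) ^ H * ℓ (b n)
  have hnR : (0 : ℝ) < n := by exact_mod_cast hn0
  have hbR : (0 : ℝ) < b n := by exact_mod_cast hb0
  have e : b n * (sampleMean X n ω - mu) =
      a' * ((b n : ℝ) / n * (a / a')) * ((partialSum X 1 n ω - n * mu) / a) := by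
    rw [sampleMean]
    field_simp
  have hκ0 : 0 < (b n : ℝ) / n * (a / a') := by positivity
  rw [e, abs_mul, abs_of_pos (by positivity)] at hω'
  rw [lt_div_iff₀ hK] at hκn
  have h2 : a' * ((b n : ℝ) / n * (a / a')) * |(partialSum X 1 n ω - n * mu) / a| ≤
      a' * ((b n : ℝ) / n * (a / a')) * K := by gcongr
  nlinarith

end WeakLimits


/-! ### Uniform convergence of monotone functions -/

/-- Pólya's argument: a finite grid traps each point of `[A, B]` between points where `F` varies by
at most `ε`. Monotonicity sandwiches `E`, losing `ε` from the grid and `ε` from the approximation;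
outside `[A, B]` both functions are near `0` or near `1`. -/
theorem exists_finset_forall_abs_sub_le {F : ℝ → ℝ} (hF : Continuous F) (hmono : Monotone F)
    (hbot : Tendsto F atBot (𝓝 0)) (htop : Tendsto F atTop (𝓝 1)) {ε : ℝ} (hε : 0 < ε) :
    ∃ S : Finset ℝ, ∀ E : ℝ → ℝ, Monotone E → (∀ x, E x ∈ Set.Icc (0 : ℝ) 1) →
      (∀ u ∈ S, |E u - F u| ≤ ε) → ∀ x, |E x - F x| ≤ 2 * ε := by
  classical
  have hF0 : ∀ x, 0 ≤ F x := fun x => hmono.le_of_tendsto hbot x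
  have hF1 : ∀ x, F x ≤ 1 := fun x => hmono.ge_of_tendsto htop x
  obtain ⟨A, hA⟩ := (hbot.eventually_lt_const hε).exists
  obtain ⟨B, hB⟩ := (htop.eventually_const_lt (by linarith : 1 - ε < 1)).exists
  have hcomp := (isCompact_Icc (a := A) (b := B)).induction_on
    (p := fun s => ∃ S : Finset ℝ, ∀ x ∈ s, ∃ u ∈ S, ∃ v ∈ S, u ≤ x ∧ x ≤ v ∧ F v - F u ≤ ε)
    ⟨∅, by simp⟩ (fun s t hst ⟨S, hS⟩ => ⟨S, fun x hx => hS x (hst hx)⟩)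
    (fun s t ⟨S, hS⟩ ⟨T, hT⟩ => ⟨S ∪ T, fun x hx => by
      rcases hx with hx | hx
      · obtain ⟨u, hu, v, hv, h⟩ := hS x hx
        exact ⟨u, Finset.mem_union_left _ hu, v, Finset.mem_union_left _ hv, h⟩
      · obtain ⟨u, hu, v, hv, h⟩ := hT x hx
        exact ⟨u, Finset.mem_union_right _ hu, v, Finset.mem_union_right _ hv, h⟩⟩) ?_
  · obtain ⟨S, hS⟩ := hcomp
    refine ⟨insert A (insert B S), fun E hE hE01 hES x => ?_⟩
    have hEA := abs_le.1 (hES A (by simp))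
    have hEB := abs_le.1 (hES B (by simp))
    have := hF0 x
    have := hF1 x
    have := (hE01 x).1
    have := (hE01 x).2
    rw [abs_le]
    rcases lt_or_ge x A with hxA | hxA
    · have := hE hxA.le
      have := hmono hxA.le
      constructor <;> linarith
    rcases lt_or_ge B x with hxB | hxB
    · have := hE hxB.le
      have := hmono hxB.le
      constructor <;> linarith
    obtain ⟨u, hu, v, hv, hux, hxv, huv⟩ := hS x ⟨hxA, hxB⟩
    have hEu := abs_le.1 (hES u (by simp [hu]))
    have hEv := abs_le.1 (hES v (by simp [hv]))
    have := hE hux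
    have := hE hxv
    have := hmono hux
    have := hmono hxv
    constructor <;> linarith
  · intro x _
    obtain ⟨r, hr, hball⟩ := Metric.continuousAt_iff.1 hF.continuousAt (ε / 2) (half_pos hε)
    have h1 := hball (x := x + r / 2) (by
      rw [Real.dist_eq, add_sub_cancel_left, abs_of_pos] <;> linarith)
    have h2 := hball (x := x - r / 2) (by
      rw [Real.dist_eq, sub_sub_cancel_left, abs_neg, abs_of_pos] <;> linarith)
    rw [Real.dist_eq, abs_lt] at h1 h2
    refine ⟨Set.Icc (x - r / 2) (x + r / 2), mem_nhdsWithin_of_mem_nhds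
      (Icc_mem_nhds (by linarith) (by linarith)), {x - r / 2, x + r / 2}, fun y hy => ?_⟩
    exact ⟨x - r / 2, by simp, x + r / 2, by simp, hy.1, hy.2, by linarith⟩

/-! ### The limiting distribution function -/

section LimitCDF

variable {Ω : Type*} [MeasurableSpace Ω] {P : Measure Ω} [IsProbabilityMeasure P]
  {Y : ℝ≥0 → Ω → ℝ}

theorem monotone_limitCDF : Monotone (limitCDF Y P) := fun _ _ hxy =>
  measureReal_mono fun _ hω => le_trans hω hxy

theorem limitCDF_eq_cdf (hT : AEMeasurable (limitStat Y) P) :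
    limitCDF Y P = cdf (P.map (limitStat Y)) := by
  have := Measure.isProbabilityMeasure_map hT
  ext x
  rw [cdf_eq_real, map_measureReal_apply_of_aemeasurable hT measurableSet_Iic]
  rfl

end LimitCDF

/-! ### Frequencies of sets among the block statistics -/

section EmpiricalCDF

variable {Ω : Type*} {X : ℤ → Ω → ℝ} {n b : ℕ}

/-- The proportion of the block statistics which belong to `C`. -/
noncomputable def blockFrequency (X : ℤ → Ω → ℝ) (n b : ℕ) (C : Set ℝ) (ω : Ω) : ℝ :=
  ((n : ℝ) - b + 1)⁻¹ * ∑ i ∈ Finset.Icc (1 : ℤ) ((n : ℤ) - b + 1),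
    C.indicator (fun _ => (1 : ℝ)) (blockStat X n b i ω)

theorem empiricalCDF_eq_blockFrequency (x : ℝ) (ω : Ω) :
    empiricalCDF X n b x ω = blockFrequency X n b (Set.Iic x) ω := by
  simp [empiricalCDF, blockFrequency, Set.indicator_apply]

theorem blockFrequency_nonneg (hbn : b ≤ n) (C : Set ℝ) (ω : Ω) :
    0 ≤ blockFrequency X n b C ω := by
  have : (b : ℝ) ≤ n := by exact_mod_cast hbn
  exact mul_nonneg (inv_nonneg.2 (by linarith))
    (Finset.sum_nonneg fun i _ => Set.indicator_nonneg (fun _ _ => zero_le_one) _)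

theorem blockFrequency_mono (hbn : b ≤ n) {C C' : Set ℝ} (h : C ⊆ C') (ω : Ω) :
    blockFrequency X n b C ω ≤ blockFrequency X n b C' ω := by
  have : (b : ℝ) ≤ n := by exact_mod_cast hbn
  exact mul_le_mul_of_nonneg_left (Finset.sum_le_sum fun i _ =>
    Set.indicator_le_indicator_of_subset h (fun _ => zero_le_one) _) (inv_nonneg.2 (by linarith))

theorem blockFrequency_add_compl (hbn : b ≤ n) (C : Set ℝ) (ω : Ω) :
    blockFrequency X n b C ω + blockFrequency X n b Cᶜ ω = 1 := by
  have h0 : (b : ℝ) ≤ n := by exact_mod_cast hbn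
  have h1 : (((n : ℤ) - b + 1).toNat : ℝ) = (n : ℝ) - b + 1 := by
    have : (((n : ℤ) - b + 1).toNat : ℤ) = (n : ℤ) - b + 1 := Int.toNat_of_nonneg (by omega)
    exact_mod_cast this
  rw [blockFrequency, blockFrequency, ← mul_add, ← Finset.sum_add_distrib]
  simp only [Set.indicator_self_add_compl_apply, Finset.sum_const, Int.card_Icc, nsmul_eq_mul,
    mul_one, add_sub_cancel_right, h1]
  exact inv_mul_cancel₀ (by linarith)

theorem blockFrequency_le_one (hbn : b ≤ n) (C : Set ℝ) (ω : Ω) :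
    blockFrequency X n b C ω ≤ 1 := by
  linarith [blockFrequency_add_compl (X := X) hbn C ω, blockFrequency_nonneg (X := X) hbn Cᶜ ω]

end EmpiricalCDF

/-! ### Consistency of block sampling -/

section Consistency

variable {Ω Ω' : Type*} [MeasurableSpace Ω] [MeasurableSpace Ω'] {P : Measure Ω}
  [IsProbabilityMeasure P] {P' : Measure Ω'} [IsProbabilityMeasure P'] {J l : ℕ}
  {Z : ℤ → Ω → Fin J → ℝ} {G : (Fin (l + 1) → Fin J → ℝ) → ℝ} {X : ℤ → Ω → ℝ} {mu H : ℝ}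
  {ℓ : ℝ → ℝ} {Y : ℝ≥0 → Ω' → ℝ} {b : ℕ → ℕ}

/-- The values of a block for which the centered block statistic belongs to `C`, or the
normalizer is at most `d`. -/
def badBlocks (G : (Fin (l + 1) → Fin J → ℝ) → ℝ) (mu : ℝ) (b : ℕ) (C : Set ℝ) (d : ℝ) :
    Set (Fin (l + b) × Fin J → ℝ) :=
  {v | centeredStat (blockProcess G b) mu b 1 v ∈ C ∨
    blockNormalizer (blockProcess G b) 1 b v ≤ d}

theorem measurableSet_badBlocks (hG : Measurable G) {C : Set ℝ} (hC : MeasurableSet C) (b : ℕ)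
    (d : ℝ) : MeasurableSet (badBlocks G mu b C d) :=
  (measurable_centeredStat (measurable_blockProcess hG b) mu b 1 hC).union
    (measurable_blockNormalizer (measurable_blockProcess hG b) 1 b measurableSet_Iic)

theorem block_mem_badBlocks_iff {Ω : Type*} {X : ℤ → Ω → ℝ} {Z : ℤ → Ω → Fin J → ℝ}
    (hX : ∀ i ω, X i ω = G fun a => Z (i - ((a : ℕ) : ℤ)) ω) {b : ℕ} {C : Set ℝ} {d : ℝ} (i : ℤ)
    (ω : Ω) : (fun p => block Z (i - l) (l + b) p ω) ∈ badBlocks G mu b C d ↔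
      centeredStat X mu b i ω ∈ C ∨ blockNormalizer X i b ω ≤ d := by
  have h := eq_blockProcess hX (b := b) (i := i) ω
  rw [badBlocks, Set.mem_ofPred_eq, centeredStat_shift mu (1 - i) h, blockNormalizer_shift _ h,
    add_sub_cancel]

/-- By stationarity the block starting at `1` may be replaced by the one starting at `1 - l`, which
generates `X_1, …, X_b`; a union bound follows. -/
theorem integral_indicator_badBlocks_le {P : Measure Ω} (hZ_stat : IsStationary Z P)
    (hG : Measurable G)
    (hX : ∀ i ω, X i ω = G fun a => Z (i - ((a : ℕ) : ℤ)) ω) {C : Set ℝ} (hC : MeasurableSet C)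
    (b : ℕ) (d : ℝ) :
    ∫ ω, (badBlocks G mu b C d).indicator (fun _ => (1 : ℝ)) (fun p => block Z 1 (l + b) p ω) ∂P ≤
      P.real {ω | centeredStat X mu b 1 ω ∈ C} + P.real {ω | blockNormalizer X 1 b ω ≤ d} := by
  have hS := measurableSet_badBlocks (mu := mu) hG hC b d
  have hid := identDistrib_block hZ_stat (1 - l) (l + b)
  have h := hid.comp (u := (badBlocks G mu b C d).indicator fun _ => (1 : ℝ))
    (measurable_const.indicator hS)
  refine (h.integral_eq.symm.le).trans ?_
  have e : ((badBlocks G mu b C d).indicator fun _ => (1 : ℝ)) ∘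
      (fun ω p => block Z (1 - l) (l + b) p ω) =
      ({ω | centeredStat X mu b 1 ω ∈ C} ∪ {ω | blockNormalizer X 1 b ω ≤ d}).indicator
        fun _ => (1 : ℝ) := by
    ext ω
    by_cases hω : (fun p => block Z (1 - l) (l + b) p ω) ∈ badBlocks G mu b C d
    · rw [Function.comp_apply, Set.indicator_of_mem hω, Set.indicator_of_mem]
      exact (block_mem_badBlocks_iff hX 1 ω).1 hω
    · rw [Function.comp_apply, Set.indicator_of_notMem hω, Set.indicator_of_notMem]
      exact fun h => hω ((block_mem_badBlocks_iff hX 1 ω).2 h)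
  have hnull : NullMeasurableSet
      ({ω | centeredStat X mu b 1 ω ∈ C} ∪ {ω | blockNormalizer X 1 b ω ≤ d}) P := by
    have := hid.aemeasurable_fst.nullMeasurable hS
    convert this using 1
    ext ω
    exact (block_mem_badBlocks_iff hX 1 ω).symm
  rw [e, integral_indicator₀ hnull, setIntegral_const, smul_eq_mul, mul_one]
  exact measureReal_union_le _ _

/-- Asymptotically, the frequency of a set `C` among the block statistics does not exceed the
limiting probability of any closed set containing a uniform neighborhood of `C`. -/
theorem eventually_measureReal_blockFrequency_lt
    (hZ_gauss : IsGaussianProcess Z P) (hZ_stat : IsStationary Z P)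
    (hZ_mean : ∀ i j, ∫ ω, Z i ω j ∂P = 0) (hG : Measurable G)
    (hX : ∀ i ω, X i ω = G fun a => Z (i - ((a : ℕ) : ℤ)) ω)
    (hY : IsSSSI H Y P') (hH : H < 1) (hℓ : IsSlowlyVarying ℓ)
    (hpath : ∀ ω, IsCadlag fun t => Y (unitInterval.toNNReal t) ω)
    (hne : ∀ᵐ ω ∂P', ∃ t : unitInterval, Y (unitInterval.toNNReal t) ω ≠ 0)
    (hconv : TendstoInDistribution (fun n : ℕ => partialSumPath X mu H ℓ n) atTop
      (limitPath Y hpath) (fun _ => P) P')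
    (hb_top : Tendsto b atTop atTop)
    (hb_o : (fun n => (b n : ℝ)) =o[atTop] fun n : ℕ => (n : ℝ))
    (hb_corr : (fun n : ℕ => ∑ k ∈ Finset.range (n + 1), blockCorr Z P k (l + b n))
      =o[atTop] fun n : ℕ => (n : ℝ))
    {C C' : Set ℝ} (hC' : IsClosed C') {ε : ℝ} (hε : 0 < ε)
    (hCC' : ∀ t ∈ C, ∀ u, |t - u| ≤ ε → u ∈ C') {η δ : ℝ} (hη : 0 < η) (hδ : 0 < δ) :
    ∀ᶠ n in atTop, P.real {ω | P'.real {ω | limitStat Y ω ∈ C'} + η ≤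
      blockFrequency X n (b n) C ω} < δ := by
  -- The normalizer falls below `c a_b` with probability less than `η/4`. Another `η/4` covers the
  -- weak limit of the centered statistic, and `η/2` is left for the fluctuation of the average.
  obtain ⟨c, hc, hDc⟩ := exists_pos_measureReal_le_lt
    (aemeasurable_bridgeSq_limitPath hY hpath).sqrt
    ((ae_bridgeSq_limitPath_pos hY hH hpath hne).mono fun ω h => Real.sqrt_pos.2 h)
    (by positivity : 0 < η / 4)
  have h1 := hb_top.eventually (eventually_measureReal_blockNormalizer_le_lt hY hℓ hpath hconv hDc)
  have h2 := hb_top.eventually (eventually_measureReal_centeredStat_mem_lt hY hH hℓ hpath hne hconv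
    hC' (lt_add_of_pos_right _ (by positivity : 0 < η / 4)))
  have h3 := eventually_measureReal_sampleMean_lt hY hH hℓ hpath hconv hb_top hb_o
    (mul_pos hε hc) (half_pos hδ)
  have h4 : ∀ᶠ n : ℕ in atTop, 8 * ((∑ k ∈ Finset.range (n + 1), blockCorr Z P k (l + b n)) / n) /
      (η / 2) ^ 2 < δ / 2 := by
    have := (hb_corr.tendsto_div_nhds_zero.const_mul 8).div_const ((η / 2) ^ 2)
    rw [mul_zero, zero_div] at this
    exact this.eventually_lt_const (half_pos hδ)
  filter_upwards [h1, h2, h3, h4, hb_top.eventually (hℓ.eventually_scale_pos H),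
    hb_o.def (by norm_num : (0 : ℝ) < 1 / 2), eventually_gt_atTop 0] with
    n h1 h2 h3 h4 ⟨hb0, ha⟩ hbn hn0
  set a := (b n : ℝ) ^ H * ℓ (b n) with ha_def
  have hnR : (0 : ℝ) < n := by exact_mod_cast hn0
  have hbn2 : (b n : ℝ) ≤ 1 / 2 * n := by simpa using hbn
  have hbn' : b n ≤ n := by
    have : (b n : ℝ) ≤ n := by linarith
    exact_mod_cast this
  set N := n - b n + 1 with hN_def
  have hNR : (N : ℝ) = (n : ℝ) - b n + 1 := by rw [hN_def]; push_cast [hbn']; ring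
  have hNZ : (N : ℤ) = (n : ℤ) - b n + 1 := by rw [hN_def]; push_cast [hbn']; ring
  have hN0 : 0 < N := by omega
  have hNn : N ≤ n := by omega
  set S := badBlocks G mu (b n) C' (c * a) with hS_def
  set f : (Fin (l + b n) × Fin J → ℝ) → ℝ := S.indicator fun _ => 1 with hf_def
  have hf : Measurable f :=
    measurable_const.indicator (measurableSet_badBlocks hG hC'.measurableSet _ _)
  have hf01 : ∀ v, f v ∈ Set.Icc (0 : ℝ) 1 := fun v =>
    ⟨Set.indicator_nonneg (fun _ _ => zero_le_one) v,
      Set.indicator_le_self' (fun _ _ => zero_le_one) v⟩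
  have hmean := integral_indicator_badBlocks_le (mu := mu) hZ_stat hG hX hC'.measurableSet (b n)
    (c * a)
  have hlln := measureReal_block_average_le hZ_gauss hZ_stat hZ_mean hf hf01 (l : ℤ) hN0
    (half_pos hη)
  have hrho : 4 * (N : ℝ)⁻¹ * (∑ k ∈ Finset.range (N + 1), blockCorr Z P k (l + b n)) /
      (η / 2) ^ 2 ≤
      8 * ((∑ k ∈ Finset.range (n + 1), blockCorr Z P k (l + b n)) / n) / (η / 2) ^ 2 := by
    -- Since `b ≤ n/2`, the number of blocks is at least `n/2`; this turns the constant `4` into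
    -- `8`.
    have hinv : (N : ℝ)⁻¹ ≤ 2 / n := by
      rw [inv_eq_one_div, div_le_div_iff₀ (by positivity) hnR, hNR]
      linarith
    have hsum : ∑ k ∈ Finset.range (N + 1), blockCorr Z P k (l + b n) ≤
        ∑ k ∈ Finset.range (n + 1), blockCorr Z P k (l + b n) :=
      Finset.sum_le_sum_of_subset_of_nonneg (Finset.range_subset_range.2 (by omega))
        fun k _ _ => blockCorr_nonneg _ _
    have hsum0 : 0 ≤ ∑ k ∈ Finset.range (N + 1), blockCorr Z P k (l + b n) :=
      Finset.sum_nonneg fun k _ => blockCorr_nonneg _ _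
    calc _ ≤ 4 * (2 / (n : ℝ)) * (∑ k ∈ Finset.range (n + 1), blockCorr Z P k (l + b n)) /
          (η / 2) ^ 2 := by gcongr
      _ = _ := by ring
  -- When the sample mean is accurate, each block statistic in `C` comes from a block whose centered
  -- statistic is in `C'` or whose normalizer is small. The frequency is thus dominated by an
  -- average of functions of blocks not involving the sample mean.
  have hsub : {ω | P'.real {ω | limitStat Y ω ∈ C'} + η ≤ blockFrequency X n (b n) C ω} ⊆
      {ω | ε * c * a < |b n * (sampleMean X n ω - mu)|} ∪
      {ω | (∫ ω', f (fun p => block Z 1 (l + b n) p ω') ∂P) + η / 2 ≤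
        (N : ℝ)⁻¹ * ∑ i ∈ Finset.Icc (1 : ℤ) N, f fun p => block Z (i - l) (l + b n) p ω} := by
    intro ω hω
    by_contra hnot
    rw [Set.mem_union, not_or] at hnot
    obtain ⟨hgood, havg⟩ := hnot
    have hgood' : |b n * (sampleMean X n ω - mu)| ≤ ε * (c * a) := by
      rw [← mul_assoc]; exact not_lt.1 hgood
    have hfreq : blockFrequency X n (b n) C ω ≤
        (N : ℝ)⁻¹ * ∑ i ∈ Finset.Icc (1 : ℤ) N, f fun p => block Z (i - l) (l + b n) p ω := by
      rw [blockFrequency, ← hNR, ← hNZ]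
      refine mul_le_mul_of_nonneg_left (Finset.sum_le_sum fun i _ => ?_) (by positivity)
      refine Set.indicator_apply_le' (fun hmem => ?_) fun _ => (hf01 _).1
      rw [hf_def, Set.indicator_of_mem]
      rw [hS_def, block_mem_badBlocks_iff hX]
      rcases le_or_gt (blockNormalizer X i (b n) ω) (c * a) with hle | hlt
      · exact Or.inr hle
      · exact Or.inl (hCC' _ hmem _
          (abs_blockStat_sub_centeredStat_le (mul_pos hc ha) hlt.le hgood'))
    have hω' : P'.real {ω | limitStat Y ω ∈ C'} + η ≤ blockFrequency X n (b n) C ω := hω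
    exact havg (show _ + η / 2 ≤ _ by linarith)
  calc _ ≤ _ := measureReal_mono hsub
    _ ≤ _ := measureReal_union_le _ _
    _ < δ := by linarith

end Consistency


/-! ### From frequencies of sets to the empirical distribution function -/

section Consistency

variable {Ω Ω' : Type*} [MeasurableSpace Ω] [MeasurableSpace Ω']
  {P : Measure Ω} [IsProbabilityMeasure P] {P' : Measure Ω'} [IsProbabilityMeasure P']
  {X : ℤ → Ω → ℝ} {Y : ℝ≥0 → Ω' → ℝ} {b : ℕ → ℕ}

theorem measureReal_limitStat_ge_le (hT : AEMeasurable (limitStat Y) P') {u v : ℝ} (huv : u < v) :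
    P'.real {ω | limitStat Y ω ∈ Set.Ici v} ≤ 1 - limitCDF Y P' u := by
  have hnull : NullMeasurableSet {ω | limitStat Y ω ≤ u} P' := hT.nullMeasurable measurableSet_Iic
  have h := probReal_compl_eq_one_sub₀ hnull
  rw [limitCDF, ← h]
  exact measureReal_mono fun ω hω => not_le.2 (huv.trans_le hω)

/-- If block frequencies of sets are asymptotically bounded by the limiting probabilities of closed
neighborhoods, then the empirical distribution function is consistent at continuity points. -/
theorem tendstoInMeasure_empiricalCDF (hT : AEMeasurable (limitStat Y) P')
    (hb : ∀ᶠ n in atTop, b n ≤ n)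
    (hfreq : ∀ C C' : Set ℝ, IsClosed C' → ∀ ε > 0, (∀ t ∈ C, ∀ u, |t - u| ≤ ε → u ∈ C') →
      ∀ η > 0, ∀ δ > 0, ∀ᶠ n in atTop, P.real {ω | P'.real {ω | limitStat Y ω ∈ C'} + η ≤
        blockFrequency X n (b n) C ω} < δ)
    {x : ℝ} (hx : ContinuousAt (limitCDF Y P') x) :
    TendstoInMeasure P (fun (n : ℕ) ω => empiricalCDF X n (b n) x ω) atTop
      fun _ => limitCDF Y P' x := by
  rw [tendstoInMeasure_iff_measureReal_dist]
  intro r hr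
  obtain ⟨ε, hε, hball⟩ := Metric.continuousAt_iff.1 hx (r / 2) (half_pos hr)
  have hup := (abs_lt.1 (hball (x := x + ε / 2)
    (by rw [Real.dist_eq, add_sub_cancel_left, abs_of_pos (half_pos hε)]; linarith))).2
  have hlo := (abs_lt.1 (hball (x := x - ε / 2)
    (by rw [Real.dist_eq, sub_sub_cancel_left, abs_neg, abs_of_pos (half_pos hε)]; linarith))).1
  have h1 := hfreq (Set.Iic x) (Set.Iic (x + ε / 2)) isClosed_Iic (ε / 2) (half_pos hε)
    (fun t ht u hu => by
      have := (abs_le.1 hu).1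
      have : t ≤ x := ht
      exact Set.mem_Iic.2 (by linarith)) (r / 2) (half_pos hr)
  -- The lower bound is the upper bound for the complement. The margin `ε/4` leaves room between `x
  -- - ε/2` and `x - ε/4`, as the closed half-line may carry an atom at its endpoint.
  have h2 := hfreq (Set.Iic x)ᶜ (Set.Ici (x - ε / 4)) isClosed_Ici (ε / 4) (by positivity)
    (fun t ht u hu => by
      have := (abs_le.1 hu).2
      have : x < t := not_le.1 ht
      exact Set.mem_Ici.2 (by linarith)) (r / 2) (half_pos hr)
  have hge := measureReal_limitStat_ge_le hT (by linarith : x - ε / 2 < x - ε / 4)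
  refine tendsto_order.2 ⟨fun a ha => .of_forall fun n => ha.trans_le measureReal_nonneg,
    fun δ hδ => ?_⟩
  filter_upwards [h1 (δ / 2) (half_pos hδ), h2 (δ / 2) (half_pos hδ), hb] with n h1 h2 hb
  refine (measureReal_mono (s₂ := _ ∪ _) (fun ω hω => ?_) (measure_ne_top _ _)).trans_lt
    ((measureReal_union_le _ _).trans_lt ((add_lt_add h1 h2).trans_eq (add_halves δ)))
  have hω' : r ≤ |empiricalCDF X n (b n) x ω - limitCDF Y P' x| := hω
  have hsum := blockFrequency_add_compl (X := X) hb (Set.Iic x) ω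
  rw [empiricalCDF_eq_blockFrequency] at hω'
  rcases le_abs'.1 hω' with h | h
  · right
    rw [Set.mem_ofPred_eq]
    linarith
  · left
    change limitCDF Y P' (x + ε / 2) + _ ≤ _
    linarith

/-- Consistency of the empirical distribution function at every point implies uniform consistency
if the limit is continuous. -/
theorem tendstoInMeasure_iSup_empiricalCDF (hT : AEMeasurable (limitStat Y) P')
    (hb : ∀ᶠ n in atTop, b n ≤ n) (hF : Continuous (limitCDF Y P'))
    (h : ∀ x, TendstoInMeasure P (fun (n : ℕ) ω => empiricalCDF X n (b n) x ω) atTop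
      fun _ => limitCDF Y P' x) :
    TendstoInMeasure P
      (fun (n : ℕ) ω => ⨆ x : ℝ, |empiricalCDF X n (b n) x ω - limitCDF Y P' x|)
      atTop fun _ => 0 := by
  rw [tendstoInMeasure_iff_measureReal_dist]
  intro r hr
  -- Errors of at most `r/4` on the grid give a uniform error of at most `r/2`, strictly less than
  -- `r`.
  obtain ⟨S, hS⟩ := exists_finset_forall_abs_sub_le hF monotone_limitCDF
    (limitCDF_eq_cdf hT ▸ tendsto_cdf_atBot _) (limitCDF_eq_cdf hT ▸ tendsto_cdf_atTop _)
    (by positivity : 0 < r / 4)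
  have hsum : Tendsto (fun n => ∑ u ∈ S,
      P.real {ω | r / 4 ≤ dist (empiricalCDF X n (b n) u ω) (limitCDF Y P' u)}) atTop (𝓝 0) := by
    rw [← Finset.sum_const_zero (s := S)]
    exact tendsto_finsetSum _ fun u _ =>
      tendstoInMeasure_iff_measureReal_dist.1 (h u) (r / 4) (by positivity)
  refine squeeze_zero' (.of_forall fun n => measureReal_nonneg) (hb.mono fun n hb => ?_) hsum
  refine (measureReal_mono (fun ω hω => ?_) (measure_ne_top _ _)).trans
    (measureReal_biUnion_finset_le S _)
  by_contra hnot
  have hsmall : ∀ u ∈ S, |empiricalCDF X n (b n) u ω - limitCDF Y P' u| ≤ r / 4 := fun u hu =>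
    le_of_not_ge fun hle => hnot (Set.mem_biUnion hu hle)
  have hall := hS (fun x => empiricalCDF X n (b n) x ω)
    (fun x y hxy => by
      simp only [empiricalCDF_eq_blockFrequency]
      exact blockFrequency_mono hb (Set.Iic_subset_Iic.2 hxy) ω)
    (fun x => by
      rw [empiricalCDF_eq_blockFrequency]
      exact ⟨blockFrequency_nonneg hb _ ω, blockFrequency_le_one hb _ ω⟩) hsmall
  have hle : ⨆ x : ℝ, |empiricalCDF X n (b n) x ω - limitCDF Y P' x| ≤ 2 * (r / 4) := ciSup_le hall
  have hnn : 0 ≤ ⨆ x : ℝ, |empiricalCDF X n (b n) x ω - limitCDF Y P' x| :=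
    Real.iSup_nonneg fun x => abs_nonneg _
  have hω' : r ≤ dist (⨆ x : ℝ, |empiricalCDF X n (b n) x ω - limitCDF Y P' x|) 0 := hω
  rw [Real.dist_0_eq_abs, abs_of_nonneg hnn] at hω'
  linarith

end Consistency

end BlockSampling

theorem theorem1
    {Ω Ω' : Type*} [MeasurableSpace Ω] [MeasurableSpace Ω']
    (P : Measure Ω) [IsProbabilityMeasure P] (P' : Measure Ω') [IsProbabilityMeasure P']
    -- the underlying centered stationary Gaussian process with nonsingular block covariances
    {J : ℕ} (Z : ℤ → Ω → Fin J → ℝ)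
    (hZ_gauss : IsGaussianProcess Z P)
    (hZ_stat : BlockSampling.IsStationary Z P)
    (hZ_mean : ∀ i j, ∫ ω, Z i ω j ∂P = 0)
    (hZ_cov : ∀ m : ℕ, (BlockSampling.covMat Z P m).det ≠ 0)
    -- the observed process and its mean
    (l : ℕ) (G : (Fin (l + 1) → Fin J → ℝ) → ℝ) (hG : Measurable G)
    (X : ℤ → Ω → ℝ) (hX : ∀ i ω, X i ω = G fun a => Z (i - ((a : ℕ) : ℤ)) ω)
    (hX_int : Integrable (X 0) P) (mu : ℝ) (hmu : mu = ∫ ω, X 0 ω ∂P)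
    -- weak convergence of the partial sums in `D[0,1]` with the `M₂` topology
    (H : ℝ) (hH0 : 0 < H) (hH1 : H < 1)
    (ℓ : ℝ → ℝ) (hℓ : BlockSampling.IsSlowlyVarying ℓ)
    (Y : ℝ≥0 → Ω' → ℝ) (hY : BlockSampling.IsSSSI H Y P')
    (hY_path : ∀ ω, BlockSampling.IsCadlag fun t => Y (unitInterval.toNNReal t) ω)
    (hY_ne : ∀ᵐ ω ∂P', ∃ t : unitInterval, Y (unitInterval.toNNReal t) ω ≠ 0)
    (hconv : TendstoInDistribution (fun n : ℕ => BlockSampling.partialSumPath X mu H ℓ n) atTop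
      (fun ω => (⟨fun t => Y (unitInterval.toNNReal t) ω, hY_path ω⟩ :
        BlockSampling.SkorokhodSpace)) (fun _ => P) P')
    -- the block sizes
    (b : ℕ → ℕ) (hb_top : Tendsto b atTop atTop)
    (hb_o : (fun n => (b n : ℝ)) =o[atTop] fun n : ℕ => (n : ℝ))
    (hb_corr : (fun n : ℕ => ∑ k ∈ Finset.range (n + 1), BlockSampling.blockCorr Z P k (l + b n))
      =o[atTop] fun n : ℕ => (n : ℝ)) :
    (∀ x : ℝ, ContinuousAt (BlockSampling.limitCDF Y P') x →
      TendstoInMeasure P (fun (n : ℕ) ω => BlockSampling.empiricalCDF X n (b n) x ω) atTop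
        fun _ => BlockSampling.limitCDF Y P' x) ∧
    (Continuous (BlockSampling.limitCDF Y P') →
      TendstoInMeasure P
        (fun (n : ℕ) ω =>
          ⨆ x : ℝ, |BlockSampling.empiricalCDF X n (b n) x ω - BlockSampling.limitCDF Y P' x|)
        atTop fun _ => 0) := by
  have hT := BlockSampling.aemeasurable_limitStat hY hY_path
  have hb : ∀ᶠ n in atTop, b n ≤ n := by
    filter_upwards [hb_o.def one_pos] with n hn
    simpa using hn
  have h := fun x => BlockSampling.tendstoInMeasure_empiricalCDF (P := P) (X := X) (x := x) hT hb
    fun C C' hC' ε hε hCC' η hη δ hδ => BlockSampling.eventually_measureReal_blockFrequency_lt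
      hZ_gauss hZ_stat hZ_mean hG hX hY hH1 hℓ hY_path hY_ne hconv hb_top hb_o hb_corr hC' hε hCC'
      hη hδ
  exact ⟨h, fun hF => BlockSampling.tendstoInMeasure_iSup_empiricalCDF hT hb hF
    fun x => h x hF.continuousAt⟩
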